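/- Let $\Omega\subset\mathbb R^2$ be open and let $\mathcal T$ be a finite conforming triangulation of $\overline\Omega$ that exactly captures the boundary ($\partial\Omega$ is a union of edges). Consider $-\operatorname{div}(\kappa(x,u)\nabla u)+g(x,u)=f$ in $\Omega$, $u=0$ on $\partial\Omega$. **Data.** For every $\eta\in\mathbb R$ the functions $\kappa(\cdot,\eta)$, $g(\cdot,\eta)$ are measurable on $\Omega$; for a.e. $x\in\Omega$ the functions $\kappa(x,\cdot)$, $g(x,\cdot)$ are $C^1$, and with constants $0<k_\alpha<k_\beta$, $K_\eta>0$, $G_\eta$ we have, for a.e. $x\in\Omega$ and all $\eta\in\mathbb R$, $$k_\alpha\le\kappa(x,\eta)\le k_\beta,\qquad |\partial_\eta\kappa(x,\eta)|\le K_\eta,\qquad 0\le\partial_\eta g(x,\eta)\le G_\eta,$$ and $g(x,\cdot)$ is nondecreasing. **Discretization.** For nodes $q_i$ of $\mathcal T$ let $\varphi_i$ be the continuous piecewise linear nodal basis function, and let $\mathcal V$ be the span of the $\varphi_i$ with $q_i\notin\partial\Omega$. Let $\omega_{ij}$ be the union of the triangles having both $q_i$ and $q_j$ as vertices. For an edge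 $q_iq_j$, let $\theta_{ij,T}$ be the angle of a triangle $T\subset\omega_{ij}$ opposite that edge and $\theta_{i,T}$ the angle of $T$ at $q_i$. Let $\delta_{\omega_{ij}}(v)$ be the maximum of $|v(q_k)-v(q_l)|$ over the edges $q_kq_l$ of the triangles in $\omega_{ij}$, and let $|T_{\mathcal T}|$ be the largest area of a triangle of $\mathcal T$. Below, "edge" means an edge $q_iq_j$ with at least one endpoint not on $\partial\Omega$; the conditions that are not symmetric in $i,j$ are assumed for both orderings. **Mesh.** All angles of the triangles are at most $\pi/2$, and there are constants $\beta_m,\beta_M>0$ such that for every edge $$\sum_{T\subset\omega_{ij}}\cot\theta_{ij,T}>\beta_m,\qquad \sum_{T\subset\omega_{ij}}\cot\theta_{ij,T}+\sum_{T\subset\omega_{ij}}\cot\theta_{i,T}\le\beta_M .$$ **Nodal conditions on $v\in\mathcal V$.** For every edge $$\frac1{3\beta_m}\bigl(K_\eta\beta_M\,\delta_{\omega_{ij}}(v)+G_\eta|T_{\mathcal T}|\bigr)\le k_\alpha,\qquad |v(q_i)-v(q_j)|<\frac{3k_\alpha}{K_\eta},$$ and there is $\bar\varepsilon>0$ such that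 for every edge $$\frac{K_\eta\beta_M\,\delta_{\omega_{ij}}(v)}{3\beta_m}<k_\alpha-\bar\varepsilon .$$ **Linearized matrix.** For $u_1,u_2\in\mathcal V$ let $b(x)=\int_0^1\partial_\eta\kappa(x,tu_1(x)+(1-t)u_2(x))\,dt$, $c(x)=\int_0^1\partial_\eta g(x,tu_1(x)+(1-t)u_2(x))\,dt$, and let $A=(a_{ij})$, indexed by the nodes not on $\partial\Omega$, be $$a_{ij}=\int_{\omega_{ij}}\kappa(x,u_1)\nabla\varphi_j\cdot\nabla\varphi_i\,dx+\int_{\omega_{ij}}b\,\nabla u_2\cdot\nabla\varphi_i\,\varphi_j\,dx+\int_{\omega_{ij}}c\,\varphi_j\varphi_i\,dx .$$ **Claim.** Under the assumptions on the data and the mesh: 1. For all $u_1,u_2\in\mathcal V$ such that $u_2$ satisfies the nodal conditions, $A$ is monotone: $Ax\ge0$ implies $x\ge0$, entrywise. 2. Let $f\in L_2(\Omega)$, and call $u\in\mathcal V$ a discrete solution if, for all $v\in\mathcal V$, $\kappa(x,u)\nabla u\cdot\nabla v+g(x,u)v$ is integrable on $\Omega$ and $$\int_\Omega\kappa(x,u)\nabla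 u\cdot\nabla v+g(x,u)v\,dx=\int_\Omega fv\,dx .$$ If some discrete solution satisfies the nodal conditions, then it is the only discrete solution. In particular, if every discrete solution satisfies the nodal conditions, there is at most one discrete solution. -/

import Mathlib

open MeasureTheory

noncomputable section

/-- The Euclidean plane. -/
abbrev Plane : Type := EuclideanSpace ℝ (Fin 2)

/-- Data assumptions for `-div (κ(x,u) ∇u) + g(x,u) = f` on `Ω`: `κ` and `g` are Carathéodory
functions, `C¹` in the second argument, with the stated bounds. -/
structure DataBounds (Ω : Set Plane) (κ g : Plane → ℝ → ℝ) (kα kβ Kη Gη : ℝ) : Prop where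
  kα_pos : 0 < kα
  kα_lt : kα < kβ
  Kη_pos : 0 < Kη
  κ_meas : ∀ η, AEMeasurable (fun x => κ x η) (volume.restrict Ω)
  g_meas : ∀ η, AEMeasurable (fun x => g x η) (volume.restrict Ω)
  κ_C1 : ∀ᵐ x ∂(volume.restrict Ω), ContDiff ℝ 1 (κ x)
  g_C1 : ∀ᵐ x ∂(volume.restrict Ω), ContDiff ℝ 1 (g x)
  κ_bounds : ∀ᵐ x ∂(volume.restrict Ω), ∀ η, kα ≤ κ x η ∧ κ x η ≤ kβ
  κ_deriv : ∀ᵐ x ∂(volume.restrict Ω), ∀ η, |deriv (κ x) η| ≤ Kη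
  g_mono : ∀ᵐ x ∂(volume.restrict Ω), Monotone (g x)
  g_deriv : ∀ᵐ x ∂(volume.restrict Ω), ∀ η, 0 ≤ deriv (g x) η ∧ deriv (g x) η ≤ Gη

/-- A finite conforming triangulation of the open set `Ω ⊆ ℝ²` that exactly captures the
boundary: a finite pure two-dimensional simplicial complex covering `closure Ω`, for which
`∂Ω` is a union of edges. -/
structure Triangulation (Ω : Set Plane) where
  complex : Geometry.SimplicialComplex ℝ Plane
  isOpen : IsOpen Ω
  finite : complex.faces.Finite
  pure : ∀ s ∈ complex.faces, ∃ T ∈ complex.faces, s ⊆ T ∧ T.card = 3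
  space_eq : complex.space = closure Ω
  boundary : ∀ x ∈ frontier Ω, ∃ e ∈ complex.faces, e.card = 2 ∧
    x ∈ convexHull ℝ (e : Set Plane) ∧ convexHull ℝ (e : Set Plane) ⊆ frontier Ω

/-- A real square matrix `A` is monotone if `A v ≥ 0` implies `v ≥ 0` (entrywise). -/
def MonotoneMatrix {ι : Type*} [Fintype ι] (A : Matrix ι ι ℝ) : Prop :=
  ∀ v : ι → ℝ, 0 ≤ A.mulVec v → 0 ≤ v

/-- `w` is the family of barycentric coordinates of `x` in the simplex with vertex set `s`,
extended by zero to all other points. -/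
def IsBarycentric (s : Finset Plane) (x : Plane) (w : Plane → ℝ) : Prop :=
  (∀ y ∈ s, 0 ≤ w y) ∧ (∀ y, y ∉ s → w y = 0) ∧ ∑ y ∈ s, w y = 1 ∧ ∑ y ∈ s, w y • y = x

/-- The averaged derivative `x ↦ ∫₀¹ ∂h/∂η (x, t u₁(x) + (1-t) u₂(x)) dt`. -/
def meanDeriv (h : Plane → ℝ → ℝ) (u₁ u₂ : Plane → ℝ) (x : Plane) : ℝ :=
  ∫ t in (0 : ℝ)..1, deriv (h x) (t * u₁ x + (1 - t) * u₂ x)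

namespace Triangulation

variable {Ω : Set Plane} (M : Triangulation Ω)

/-- The nodes that do not lie on the Dirichlet boundary `∂Ω`. -/
def dof : Set Plane := M.complex.vertices \ frontier Ω

/-- The triangles of the mesh, as sets of three vertices. -/
def triangles : Finset (Finset Plane) := {T ∈ M.finite.toFinset | T.card = 3}

open Classical in
/-- The triangles that have both `p` and `q` as vertices. -/
def patchTriangles (p q : Plane) : Finset (Finset Plane) := {T ∈ M.triangles | p ∈ T ∧ q ∈ T}

/-- `ω_{pq}`: the union of the closed triangles that have both `p` and `q` as vertices. -/
def patch (p q : Plane) : Set Plane := ⋃ T ∈ M.patchTriangles p q, convexHull ℝ (T : Set Plane)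

/-- `p`, `q` are the endpoints of an edge of the mesh, at least one of which is not on `∂Ω`. -/
def IsEdge (p q : Plane) : Prop :=
  p ≠ q ∧ (M.patchTriangles p q).Nonempty ∧ (p ∈ M.dof ∨ q ∈ M.dof)

open Classical in
/-- The barycentric coordinates of `x` in any simplex of the mesh that contains `x` (they do not
depend on the simplex), and zero if there is none. -/
def baryCoord (x : Plane) : Plane → ℝ :=
  if h : ∃ w, ∃ s ∈ M.complex.faces, IsBarycentric s x w then h.choose else 0

/-- The piecewise linear nodal basis function `φ_q` (extended by zero outside the mesh). -/
def hat (q x : Plane) : ℝ := M.baryCoord x q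

/-- The discrete space `𝒱`, spanned by the basis functions of the nodes not on `∂Ω`. -/
def discreteSpace : Submodule ℝ (Plane → ℝ) := Submodule.span ℝ (M.hat '' M.dof)

open Classical in
/-- `cot θ⁺_{pq} + cot θ⁻_{pq}`: the sum, over the triangles `T` with edge `pq`, of the cotangent
of the angle of `T` opposite to that edge. -/
def cotOpposite (p q : Plane) : ℝ :=
  ∑ T ∈ M.patchTriangles p q, ∑ r ∈ (T.erase p).erase q, Real.cot (EuclideanGeometry.angle p r q)

open Classical in
/-- The sum, over the triangles `T` with edge `pq`, of the cotangent of the angle `θ_{p,T}` of `T`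
at the vertex `p`. -/
def cotAt (p q : Plane) : ℝ :=
  ∑ T ∈ M.patchTriangles p q, ∑ r ∈ (T.erase p).erase q, Real.cot (EuclideanGeometry.angle q p r)

/-- The angle conditions on the mesh. -/
structure AngleConditions (βm βM : ℝ) : Prop where
  βm_pos : 0 < βm
  βM_pos : 0 < βM
  nonobtuse : ∀ T ∈ M.triangles, ∀ p ∈ T, ∀ q ∈ T, ∀ r ∈ T, p ≠ q → q ≠ r → p ≠ r →
    EuclideanGeometry.angle p q r ≤ Real.pi / 2
  opposite : ∀ p q, M.IsEdge p q → βm < M.cotOpposite p q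
  smallest : ∀ p q, M.IsEdge p q → M.cotOpposite p q + M.cotAt p q ≤ βM

/-- The largest area of a triangle of the mesh. -/
def maxArea : ℝ := sSup {a | ∃ T ∈ M.triangles, a = volume.real (convexHull ℝ (T : Set Plane))}

/-- `δ_{ω_{pq}}(v)`: the maximum of `|v(a) - v(b)|` over the edges `ab` of the triangles that make
up `ω_{pq}`. -/
def patchVariation (p q : Plane) (v : Plane → ℝ) : ℝ :=
  sSup {d | ∃ T ∈ M.patchTriangles p q, ∃ a ∈ T, ∃ b ∈ T, d = |v a - v b|}

/-- The local conditions on the nodal differences of `v`. -/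
structure NodalConditions (kα Kη Gη βm βM : ℝ) (v : Plane → ℝ) : Prop where
  offDiag : ∀ p q, M.IsEdge p q →
    1 / (3 * βm) * (Kη * βM * M.patchVariation p q v + Gη * M.maxArea) ≤ kα
  diag : ∀ p q, M.IsEdge p q → |v p - v q| < 3 * kα / Kη
  strict : ∃ ε > 0, ∀ p q, M.IsEdge p q →
    Kη * βM * M.patchVariation p q v / (3 * βm) < kα - ε

instance : Finite M.dof :=
  Set.Finite.to_subtype <| ((M.finite.preimage
    (f := fun x : Plane => ({x} : Finset Plane)) Finset.singleton_injective.injOn).subset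
      fun _ hx => hx.1)

instance : Fintype M.dof := Fintype.ofFinite _

/-- The assembled matrix `A = (a_{ij})` of the linearized problem, indexed by the nodes not on
`∂Ω`. -/
def assembled (κ g : Plane → ℝ → ℝ) (u₁ u₂ : Plane → ℝ) : Matrix M.dof M.dof ℝ := fun i j =>
  (∫ x in M.patch i j, κ x (u₁ x) * inner ℝ (gradient (M.hat j) x) (gradient (M.hat i) x)) +
  (∫ x in M.patch i j,
    inner ℝ ((meanDeriv κ u₁ u₂ x • gradient u₂ x)) (gradient (M.hat i) x) * M.hat j x) +
  (∫ x in M.patch i j, meanDeriv g u₁ u₂ x * M.hat j x * M.hat i x)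

/-- `u ∈ 𝒱` solves the discrete problem with right-hand side `f`: for every `v ∈ 𝒱` the integral
of `κ(x,u) ∇u · ∇v + g(x,u) v` exists and equals the integral of `f v`. -/
def IsDiscreteSolution (κ g : Plane → ℝ → ℝ) (f u : Plane → ℝ) : Prop :=
  u ∈ M.discreteSpace ∧ ∀ v ∈ M.discreteSpace,
    IntegrableOn (fun x => κ x (u x) * inner ℝ (gradient u x) (gradient v x) + g x (u x) * v x) Ω ∧
    ∫ x in Ω, (κ x (u x) * inner ℝ (gradient u x) (gradient v x) + g x (u x) * v x) =
      ∫ x in Ω, f x * v x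

end Triangulation

end

/-! The matrix is monotone because of the signs of its entries and of its column sums. On a triangle
with vertices `p`, `q`, `r` the gradients of two basis functions have an inner product that, times
the area, is minus half the cotangent of the opposite angle. Diffusion thus contributes at most
`-(kα/2) cot` to an off-diagonal entry. The convection term is controlled by the nodal differences
of `u₂` times two cotangents, the reaction term by the area. An edge lies in at most two triangles,
so the mesh and nodal conditions make every entry of an edge strictly negative
(`IsTriple.localEntry_le`, `entry_neg`).

If the rows of the boundary nodes are kept, the test functions of each triangle sum to one. Their
gradients cancel in a column sum, and only a nonnegative reaction integral remains
(`sum_localEntry_nonneg`). Moreover, every nonempty set of interior nodes is joined by an edge to a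
node outside it (`exists_neighbour_notMem`). If `A v ≥ 0` and `N` is the set where `v < 0`, summing
the rows of `N` gives a nonnegative number; the signs force it to be negative unless `N` is empty
(`monotoneMatrix_of_columns`).

For uniqueness, the difference of two solutions solves an exact linear system: by the fundamental
theorem of calculus, `κ(u₁)∇u₁ - κ(u₂)∇u₂ = κ(u₁)∇(u₁-u₂) + b (u₁-u₂)∇u₂`, and similarly for `g`.
Hence the nodal difference lies in the kernel of `A` (`mulVec_assembled_eq_zero`), and monotonicity
applied to both of its signs makes it vanish. -/

noncomputable section

/-! ### Barycentric coordinates of a triangle in the plane -/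

/-- The determinant of two plane vectors. -/
def cross (u v : Plane) : ℝ := u 0 * v 1 - u 1 * v 0

/-- The barycentric coordinate of `x` at the vertex `p` of the triangle `pqr`. -/
def lam (p q r x : Plane) : ℝ := cross (x - q) (r - q) / cross (p - q) (r - q)

/-- The gradient of `lam p q r`. -/
def lamGrad (p q r : Plane) : Plane := (cross (p - q) (r - q))⁻¹ • !₂[(r - q) 1, -(r - q) 0]

lemma cross_rotate (p q r : Plane) : cross (q - r) (p - r) = cross (p - q) (r - q) := by
  simp only [cross, PiLp.sub_apply]; ring

lemma lam_add {p q r : Plane} (h : cross (p - q) (r - q) ≠ 0) (x : Plane) :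
    lam p q r x + lam q r p x + lam r p q x = 1 := by
  have h2 : cross (r - p) (q - p) = cross (p - q) (r - q) := by
    simp only [cross, PiLp.sub_apply]; ring
  rw [lam, lam, lam, cross_rotate p q r, h2, ← add_div, ← add_div, div_eq_one_iff_eq h]
  simp only [cross, PiLp.sub_apply]; ring

lemma lam_smul_add {p q r : Plane} (h : cross (p - q) (r - q) ≠ 0) (x : Plane) :
    lam p q r x • p + lam q r p x • q + lam r p q x • r = x := by
  have h2 : cross (r - p) (q - p) = cross (p - q) (r - q) := by
    simp only [cross, PiLp.sub_apply]; ring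
  rw [lam, lam, lam, cross_rotate p q r, h2]
  ext i
  simp only [PiLp.add_apply, PiLp.smul_apply, smul_eq_mul]
  rw [div_mul_eq_mul_div, div_mul_eq_mul_div, div_mul_eq_mul_div, ← add_div, ← add_div,
    div_eq_iff h]
  fin_cases i <;> simp only [cross, PiLp.sub_apply] <;> simp <;> ring

lemma lam_combination {p q r : Plane} (h : cross (p - q) (r - q) ≠ 0) {a b c : ℝ}
    (habc : a + b + c = 1) : lam p q r (a • p + b • q + c • r) = a := by
  obtain rfl : b = 1 - a - c := by linarith
  rw [lam, div_eq_iff h]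
  simp only [cross, PiLp.sub_apply, PiLp.add_apply, PiLp.smul_apply, smul_eq_mul]
  ring

/-- This affine form yields the gradient, the convexity of the half-planes bounding a triangle, and
the disjointness of open triangles. -/
lemma lam_eq_inner (p q r x : Plane) :
    lam p q r x = inner ℝ (lamGrad p q r) x - inner ℝ (lamGrad p q r) q := by
  rw [← inner_sub_right, lam, lamGrad, inner_smul_left]
  simp [cross, PiLp.inner_apply, Fin.sum_univ_two]
  ring

lemma hasGradientAt_lam (p q r x : Plane) : HasGradientAt (lam p q r) (lamGrad p q r) x := by
  rw [hasGradientAt_iff_hasFDerivAt]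
  have h := ((InnerProductSpace.toDual ℝ Plane (lamGrad p q r)).hasFDerivAt (x := x)).sub_const
    (inner ℝ (lamGrad p q r) q)
  exact h.congr_of_eventuallyEq (Filter.Eventually.of_forall fun y => lam_eq_inner p q r y)

lemma continuous_lam (p q r : Plane) : Continuous (lam p q r) := by
  unfold lam cross
  fun_prop

/-- The three gradients are rotated edges of a closed polygon with one common factor, so
nondegeneracy is not needed. -/
lemma lamGrad_add {p q r : Plane} :
    lamGrad p q r + lamGrad q r p + lamGrad r p q = 0 := by
  have h2 : cross (r - p) (q - p) = cross (p - q) (r - q) := by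
    simp only [cross, PiLp.sub_apply]; ring
  rw [lamGrad, lamGrad, lamGrad, cross_rotate p q r, h2, ← smul_add, ← smul_add]
  convert smul_zero _
  ext i
  fin_cases i <;> simp

/-- The cotangent formula for the gradients of two barycentric coordinates. -/
lemma inner_lamGrad {p q r : Plane} (h : cross (p - q) (r - q) ≠ 0) :
    inner ℝ (lamGrad q r p) (lamGrad p q r) * |cross (p - q) (r - q)| =
      - Real.cot (EuclideanGeometry.angle p r q) := by
  set d := cross (p - q) (r - q) with hd
  have hin : inner ℝ (lamGrad q r p) (lamGrad p q r) = - inner ℝ (p - r) (q - r) / d ^ 2 := by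
    rw [lamGrad, lamGrad, cross_rotate p q r, ← hd, inner_smul_left, inner_smul_right]
    simp [PiLp.inner_apply, Fin.sum_univ_two]
    field_simp
    ring
  have hc : ‖p - r‖ * ‖q - r‖ * Real.cos (EuclideanGeometry.angle p r q) =
      inner ℝ (p - r) (q - r) := by
    rw [mul_comm]
    exact InnerProductGeometry.cos_angle_mul_norm_mul_norm _ _
  -- Lagrange's identity: `‖a‖²‖b‖² - ⟨a, b⟩²` is the square of the determinant of `a` and `b`.
  have hs : ‖p - r‖ * ‖q - r‖ * Real.sin (EuclideanGeometry.angle p r q) = |d| := by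
    rw [mul_comm]
    refine (InnerProductGeometry.sin_angle_mul_norm_mul_norm _ _).trans ?_
    rw [← Real.sqrt_sq_eq_abs]
    congr 1
    simp only [vsub_eq_sub]
    rw [real_inner_self_eq_norm_sq, real_inner_self_eq_norm_sq, EuclideanSpace.norm_sq_eq,
      EuclideanSpace.norm_sq_eq]
    simp [hd, cross, PiLp.inner_apply, Fin.sum_univ_two]
    ring
  have hpos : 0 < |d| := abs_pos.2 h
  have hn : ‖p - r‖ * ‖q - r‖ ≠ 0 := by
    intro h0; rw [h0, zero_mul] at hs; exact hpos.ne hs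
  rw [hin, Real.cot_eq_cos_div_sin, ← mul_div_mul_left (Real.cos _) _ hn, hc, hs, ← sq_abs d]
  field_simp

lemma sum_smul_eq_of_triple {p q r : Plane} (hpq : p ≠ q) (hpr : p ≠ r) (hqr : q ≠ r)
    {α : Type*} [AddCommMonoid α] (f : Plane → α) : ∑ y ∈ ({p, q, r} : Finset Plane), f y = f p + (f q + f r) := by
  rw [Finset.sum_insert (by simp [hpq, hpr]), Finset.sum_pair hqr]

lemma cross_ne_zero {p q r : Plane} (hpq : p ≠ q) (hpr : p ≠ r) (hqr : q ≠ r)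
    (h : AffineIndependent ℝ ((↑) : ({p, q, r} : Finset Plane) → Plane)) :
    cross (p - q) (r - q) ≠ 0 := by
  intro h0
  have key : ∀ a b c : ℝ, a + b + c = 0 → a • p + b • q + c • r = 0 → a = 0 ∧ c = 0 := by
    intro a b c hs hv
    rw [affineIndependent_iff] at h
    set w : Plane → ℝ := fun y => if y = p then a else if y = q then b else c with hw
    have h1 := h Finset.univ (fun y => w y) (by
      rw [Finset.univ_eq_attach, Finset.sum_attach _ w, sum_smul_eq_of_triple hpq hpr hqr]
      simp [hw, hpq.symm, hpr.symm, hqr.symm, ← hs, add_assoc]) (by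
      rw [Finset.univ_eq_attach, Finset.sum_attach _ (fun y => w y • y),
        sum_smul_eq_of_triple hpq hpr hqr]
      simp [hw, hpq.symm, hpr.symm, hqr.symm, ← hv, add_assoc])
    have hp := h1 ⟨p, by simp⟩ (Finset.mem_univ _)
    have hr := h1 ⟨r, by simp⟩ (Finset.mem_univ _)
    simp only [hw, hpr.symm, hqr.symm, if_true, if_false] at hp hr
    exact ⟨hp, hr⟩
  -- For parallel `p - q` and `r - q`, the combination `(r - q)ᵢ (p - q) - (p - q)ᵢ (r - q)`
  -- vanishes for `i = 0, 1`. Independence kills its coefficients, so `p - q = 0`.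
  have h1 := key ((r - q) 0) ((p - q) 0 - (r - q) 0) (-(p - q) 0) (by ring) (by
    ext i
    fin_cases i
    · simp; ring
    · simp [cross] at h0 ⊢; linear_combination -h0)
  have h2 := key ((r - q) 1) ((p - q) 1 - (r - q) 1) (-(p - q) 1) (by ring) (by
    ext i
    fin_cases i
    · simp [cross] at h0 ⊢; linear_combination h0
    · simp; ring)
  apply hpq
  ext i
  fin_cases i
  · have := h1.2; simp at this ⊢; linarith
  · have := h2.2; simp at this ⊢; linarith

/-- The half-planes are convex and contain the vertices; conversely, `lam_smul_add` writes a point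
with nonnegative coordinates as a convex combination. -/
lemma convexHull_triple {p q r : Plane} (h : cross (p - q) (r - q) ≠ 0) :
    convexHull ℝ ({p, q, r} : Set Plane) =
      {x | 0 ≤ lam p q r x ∧ 0 ≤ lam q r p x ∧ 0 ≤ lam r p q x} := by
  have h2 : cross (q - r) (p - r) ≠ 0 := by rwa [cross_rotate]
  have h3 : cross (r - p) (q - p) ≠ 0 := by rwa [cross_rotate]
  refine Set.Subset.antisymm (convexHull_min ?_ ?_) ?_
  · have e1 := fun a b c habc => lam_combination h (a := a) (b := b) (c := c) habc
    have e2 := fun a b c habc => lam_combination h2 (a := a) (b := b) (c := c) habc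
    have e3 := fun a b c habc => lam_combination h3 (a := a) (b := b) (c := c) habc
    rintro x (rfl | rfl | rfl)
    · have a1 := e1 1 0 0 (by norm_num)
      have a2 := e2 0 0 1 (by norm_num)
      have a3 := e3 0 1 0 (by norm_num)
      simp only [zero_smul, one_smul, add_zero, zero_add] at a1 a2 a3
      simp [a1, a2, a3]
    · have a1 := e1 0 1 0 (by norm_num)
      have a2 := e2 1 0 0 (by norm_num)
      have a3 := e3 0 0 1 (by norm_num)
      simp only [zero_smul, one_smul, add_zero, zero_add] at a1 a2 a3
      simp [a1, a2, a3]
    · have a1 := e1 0 0 1 (by norm_num)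
      have a2 := e2 0 1 0 (by norm_num)
      have a3 := e3 1 0 0 (by norm_num)
      simp only [zero_smul, one_smul, add_zero, zero_add] at a1 a2 a3
      simp [a1, a2, a3]
  · have hc : ∀ a b c : Plane, Convex ℝ {x | 0 ≤ lam a b c x} := by
      intro a b c
      simp only [lam_eq_inner, sub_nonneg]
      exact convex_halfSpace_ge (innerSL ℝ (lamGrad a b c)).toLinearMap.isLinear _
    exact (hc _ _ _).inter ((hc _ _ _).inter (hc _ _ _))
  · rintro x ⟨h1, h2, h3⟩
    rw [← lam_smul_add h x]
    have hc := convex_convexHull ℝ ({p, q, r} : Set Plane)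
    exact hc.sum_mem (t := Finset.univ) (w := ![lam p q r x, lam q r p x, lam r p q x])
      (z := ![p, q, r]) (by intro i _; fin_cases i <;> simpa) (by
        simpa [Fin.sum_univ_three] using lam_add h x) (by
        intro i _; apply subset_convexHull; fin_cases i <;> simp) |> (by
          simpa [Fin.sum_univ_three] using ·)

lemma isOpen_lam_pos (p q r : Plane) :
    IsOpen {x | 0 < lam p q r x ∧ 0 < lam q r p x ∧ 0 < lam r p q x} :=
  (isOpen_lt continuous_const (continuous_lam _ _ _)).inter
    ((isOpen_lt continuous_const (continuous_lam _ _ _)).inter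
      (isOpen_lt continuous_const (continuous_lam _ _ _)))

lemma lam_pos_subset_interior {p q r : Plane} (h : cross (p - q) (r - q) ≠ 0) :
    {x | 0 < lam p q r x ∧ 0 < lam q r p x ∧ 0 < lam r p q x} ⊆
      interior (convexHull ℝ ({p, q, r} : Set Plane)) := by
  refine interior_maximal ?_ (isOpen_lam_pos p q r)
  rw [convexHull_triple h]
  exact fun x hx => ⟨hx.1.le, hx.2.1.le, hx.2.2.le⟩

/-! ### Integration over a triangle -/

/-- The standard triangle in `ℝ × ℝ`. -/
def stdTriangle : Set (ℝ × ℝ) := {z | 0 ≤ z.1 ∧ 0 ≤ z.2 ∧ z.1 + z.2 ≤ 1}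

lemma isCompact_stdTriangle : IsCompact stdTriangle := by
  refine (isCompact_Icc (a := ((0, 0) : ℝ × ℝ)) (b := (1, 1))).of_isClosed_subset ?_ ?_
  · exact (isClosed_le continuous_const continuous_fst).inter
      ((isClosed_le continuous_const continuous_snd).inter
        (isClosed_le (continuous_fst.add continuous_snd) continuous_const))
  · rintro ⟨s, t⟩ ⟨h1, h2, h3⟩
    simp only at h1 h2 h3
    exact ⟨⟨h1, h2⟩, ⟨by simp only; linarith, by simp only; linarith⟩⟩

lemma setIntegral_stdTriangle (F : ℝ × ℝ → ℝ) (hF : Continuous F) :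
    ∫ z in stdTriangle, F z = ∫ s in (0 : ℝ)..1, ∫ t in (0 : ℝ)..(1 - s), F (s, t) := by
  have hm : MeasurableSet stdTriangle := isCompact_stdTriangle.measurableSet
  have hint : IntegrableOn F stdTriangle := hF.continuousOn.integrableOn_compact isCompact_stdTriangle
  rw [← integral_indicator hm, Measure.volume_eq_prod, integral_prod]
  · rw [intervalIntegral.integral_of_le zero_le_one, ← integral_Icc_eq_integral_Ioc,
      ← integral_indicator measurableSet_Icc]
    congr 1
    ext s
    by_cases hs : s ∈ Set.Icc (0 : ℝ) 1
    · rw [Set.indicator_of_mem hs, intervalIntegral.integral_of_le (by linarith [hs.2]),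
        ← integral_Icc_eq_integral_Ioc, ← integral_indicator measurableSet_Icc]
      congr 1
      ext t
      have : (s, t) ∈ stdTriangle ↔ t ∈ Set.Icc 0 (1 - s) := by
        simp only [stdTriangle, Set.mem_ofPred_eq, Set.mem_Icc]
        exact ⟨fun h => ⟨h.2.1, by linarith⟩, fun h => ⟨hs.1, h.1, by linarith⟩⟩
      by_cases ht : t ∈ Set.Icc 0 (1 - s)
      · rw [Set.indicator_of_mem ht, Set.indicator_of_mem (this.2 ht)]
      · rw [Set.indicator_of_notMem ht, Set.indicator_of_notMem (fun h => ht (this.1 h))]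
    · rw [Set.indicator_of_notMem hs]
      have : ∀ t, (s, t) ∉ stdTriangle := fun t h => hs ⟨h.1, by
        have := h.2.1; have := h.2.2; simp only at *; linarith⟩
      simp [Set.indicator_of_notMem (this _)]
  · rw [← Measure.volume_eq_prod]
    exact (integrable_indicator_iff hm).2 hint

/-- The affine parametrization of the triangle `pqr` with `q` as the origin. -/
def triangleMap (p q r : Plane) (y : Plane) : Plane := q + (y 0 • (p - q) + y 1 • (r - q))

/-- The linear part of `triangleMap`. -/
def triangleLinear (p q r : Plane) : Plane →L[ℝ] Plane :=
  (EuclideanSpace.proj 0).smulRight (p - q) + (EuclideanSpace.proj 1).smulRight (r - q)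

lemma det_triangleLinear (p q r : Plane) :
    (triangleLinear p q r).det = cross (p - q) (r - q) := by
  rw [ContinuousLinearMap.det,
    ← LinearMap.det_toMatrix (EuclideanSpace.basisFun (Fin 2) ℝ).toBasis, Matrix.det_fin_two]
  simp [LinearMap.toMatrix_apply, triangleLinear, cross, mul_comm]

lemma hasFDerivAt_triangleMap (p q r y : Plane) :
    HasFDerivAt (triangleMap p q r) (triangleLinear p q r) y := by
  have := ((triangleLinear p q r).hasFDerivAt (x := y)).const_add q
  exact this

lemma lam_triangleMap {p q r : Plane} (h : cross (p - q) (r - q) ≠ 0) (y : Plane) :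
    lam p q r (triangleMap p q r y) = y 0 ∧ lam r p q (triangleMap p q r y) = y 1 ∧
      lam q r p (triangleMap p q r y) = 1 - y 0 - y 1 := by
  have h2 : cross (q - r) (p - r) ≠ 0 := by rwa [cross_rotate]
  have h3 : cross (r - p) (q - p) ≠ 0 := by rwa [cross_rotate]
  have e : triangleMap p q r y = y 0 • p + (1 - y 0 - y 1) • q + y 1 • r := by
    unfold triangleMap; module
  have e2 : triangleMap p q r y = (1 - y 0 - y 1) • q + y 1 • r + y 0 • p := by
    unfold triangleMap; module
  have e3 : triangleMap p q r y = y 1 • r + y 0 • p + (1 - y 0 - y 1) • q := by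
    unfold triangleMap; module
  refine ⟨?_, ?_, ?_⟩
  · rw [e]; exact lam_combination h (by ring)
  · rw [e3]; exact lam_combination h3 (by ring)
  · rw [e2]; exact lam_combination h2 (by ring)

/-- The measurable equivalence between `Plane` and `ℝ × ℝ`. -/
def planeEquiv : Plane ≃ᵐ ℝ × ℝ :=
  (MeasurableEquiv.toLp 2 (Fin 2 → ℝ)).symm.trans MeasurableEquiv.finTwoArrow

lemma measurePreserving_planeEquiv : MeasurePreserving planeEquiv volume volume :=
  (EuclideanSpace.volume_preserving_symm_measurableEquiv_toLp (Fin 2)).trans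
    (volume_preserving_finTwoArrow ℝ)

lemma planeEquiv_apply (y : Plane) : planeEquiv y = (y 0, y 1) := rfl

/-- Integration over a triangle in barycentric coordinates. -/
lemma setIntegral_triangle {p q r : Plane} (h : cross (p - q) (r - q) ≠ 0) (F : ℝ × ℝ → ℝ)
    (hF : Continuous F) :
    ∫ x in convexHull ℝ ({p, q, r} : Set Plane), F (lam p q r x, lam r p q x) =
      |cross (p - q) (r - q)| * ∫ s in (0 : ℝ)..1, ∫ t in (0 : ℝ)..(1 - s), F (s, t) := by
  have himg : triangleMap p q r '' (planeEquiv ⁻¹' stdTriangle) =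
      convexHull ℝ ({p, q, r} : Set Plane) := by
    rw [convexHull_triple h]
    ext x
    constructor
    · rintro ⟨y, hy, rfl⟩
      obtain ⟨e1, e2, e3⟩ := lam_triangleMap h y
      simp only [Set.mem_ofPred_eq, e1, e2, e3]
      exact ⟨hy.1, by have := hy.2.2; rw [planeEquiv_apply] at this; linarith, hy.2.1⟩
    · rintro ⟨h1, h2, h3⟩
      refine ⟨!₂[lam p q r x, lam r p q x], ⟨by simpa [planeEquiv_apply], by
        simpa [planeEquiv_apply], ?_⟩, ?_⟩
      · have := lam_add h x
        simp [planeEquiv_apply]; linarith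
      · conv_rhs => rw [← lam_smul_add h x]
        have := lam_add h x
        rw [show lam q r p x = 1 - lam p q r x - lam r p q x by linarith]
        simp only [triangleMap]
        simp
        module
  have hinj : Set.InjOn (triangleMap p q r) (planeEquiv ⁻¹' stdTriangle) := by
    intro y _ z _ hyz
    obtain ⟨e1, e2, -⟩ := lam_triangleMap h y
    obtain ⟨f1, f2, -⟩ := lam_triangleMap h z
    ext i
    fin_cases i
    · simp only [Fin.zero_eta]; rw [← e1, ← f1, hyz]
    · simp only [Fin.mk_one]; rw [← e2, ← f2, hyz]
  have hmeas := planeEquiv.measurable isCompact_stdTriangle.measurableSet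
  -- The parametrization is affine, so its Jacobian is the constant `cross`, and it turns the
  -- barycentric coordinates into Cartesian ones.
  rw [← himg, integral_image_eq_integral_abs_det_fderiv_smul volume hmeas
    (fun y _ => (hasFDerivAt_triangleMap p q r y).hasFDerivWithinAt) hinj]
  simp only [det_triangleLinear, (lam_triangleMap h _).1, (lam_triangleMap h _).2.1, smul_eq_mul]
  rw [integral_const_mul, ← setIntegral_stdTriangle F hF,
    ← measurePreserving_planeEquiv.setIntegral_preimage_emb planeEquiv.measurableEmbedding]
  simp only [planeEquiv_apply]

lemma measureReal_triangle {p q r : Plane} (h : cross (p - q) (r - q) ≠ 0) :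
    volume.real (convexHull ℝ ({p, q, r} : Set Plane)) = |cross (p - q) (r - q)| / 2 := by
  have := setIntegral_triangle h (fun _ => 1) continuous_const
  simp only [setIntegral_const, smul_eq_mul, mul_one, intervalIntegral.integral_const,
    sub_zero] at this
  rw [this, intervalIntegral.integral_sub (by simp) (by simp)]
  simp
  ring

/-- Since `|cross|` is twice the area, this integral is a third of the area, and that of a product
of two different coordinates is a twelfth. -/
lemma setIntegral_lam {p q r : Plane} (h : cross (p - q) (r - q) ≠ 0) :
    ∫ x in convexHull ℝ ({p, q, r} : Set Plane), lam p q r x = |cross (p - q) (r - q)| / 6 := by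
  have := setIntegral_triangle h (fun z => z.1) continuous_fst
  rw [this]
  simp only [intervalIntegral.integral_const, sub_zero, smul_eq_mul]
  have h2 : ∫ s in (0 : ℝ)..1, (1 - s) * s = 1 / 6 := by
    have : ∀ s : ℝ, (1 - s) * s = s - s ^ 2 := fun s => by ring
    simp only [this]
    rw [intervalIntegral.integral_sub (by simp) (by simp)]
    simp; norm_num
  rw [h2]; ring

lemma setIntegral_lam_mul_lam {p q r : Plane} (h : cross (p - q) (r - q) ≠ 0) :
    ∫ x in convexHull ℝ ({p, q, r} : Set Plane), lam p q r x * lam r p q x =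
      |cross (p - q) (r - q)| / 24 := by
  have := setIntegral_triangle h (fun z => z.1 * z.2) (continuous_fst.mul continuous_snd)
  rw [this]
  have h1 : ∀ s : ℝ, ∫ t in (0 : ℝ)..(1 - s), (s, t).1 * (s, t).2 =
      s * (((1 - s) ^ 2 - 0 ^ 2) / 2) := fun s => by
    rw [← integral_id, ← intervalIntegral.integral_const_mul]
  simp only [h1]
  have h2 : ∫ s in (0 : ℝ)..1, s * (((1 - s) ^ 2 - 0 ^ 2) / 2) = 1 / 24 := by
    have : ∀ s : ℝ, s * (((1 - s) ^ 2 - 0 ^ 2) / 2) = s / 2 - s ^ 2 + s ^ 3 / 2 := fun s => by ring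
    simp only [this]
    rw [intervalIntegral.integral_add (by apply Continuous.intervalIntegrable; fun_prop)
      (by apply Continuous.intervalIntegrable; fun_prop),
      intervalIntegral.integral_sub (by apply Continuous.intervalIntegrable; fun_prop)
      (by apply Continuous.intervalIntegrable; fun_prop)]
    simp; norm_num
  rw [h2]; ring

/-! ### The nodal basis functions -/

lemma IsBarycentric.unique {s : Finset Plane} (hs : AffineIndependent ℝ ((↑) : s → Plane))
    {x : Plane} {w w' : Plane → ℝ} (h : IsBarycentric s x w) (h' : IsBarycentric s x w') :
    w = w' := by
  funext y
  by_cases hy : y ∈ s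
  · rw [affineIndependent_iff] at hs
    have := hs Finset.univ (fun y => w y - w' y) (by
      rw [Finset.univ_eq_attach, Finset.sum_attach _ (fun y => w y - w' y),
        Finset.sum_sub_distrib, h.2.2.1, h'.2.2.1, sub_self]) (by
      rw [Finset.univ_eq_attach, Finset.sum_attach _ (fun y => (w y - w' y) • y)]
      simp only [sub_smul]
      rw [Finset.sum_sub_distrib, h.2.2.2, h'.2.2.2, sub_self]) ⟨y, hy⟩ (Finset.mem_univ _)
    exact sub_eq_zero.1 this
  · rw [h.2.1 y hy, h'.2.1 y hy]

lemma exists_isBarycentric {s : Finset Plane} {x : Plane}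
    (hx : x ∈ convexHull ℝ (s : Set Plane)) : ∃ w, IsBarycentric s x w := by
  classical
  rw [Finset.mem_convexHull'] at hx
  obtain ⟨w, h0, h1, h2⟩ := hx
  refine ⟨fun y => if y ∈ s then w y else 0, fun y hy => ?_, fun y hy => if_neg hy, ?_, ?_⟩
  · simp only [if_pos hy]; exact h0 y hy
  · rw [← h1]; exact Finset.sum_congr rfl fun y hy => if_pos hy
  · rw [← h2]; exact Finset.sum_congr rfl fun y hy => by simp only [if_pos hy]

lemma IsBarycentric.mem_convexHull {s : Finset Plane} {x : Plane} {w : Plane → ℝ}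
    (h : IsBarycentric s x w) : x ∈ convexHull ℝ (s : Set Plane) :=
  Finset.mem_convexHull'.2 ⟨w, h.1, h.2.2.1, h.2.2.2⟩

lemma IsBarycentric.mono {s t : Finset Plane} (hst : s ⊆ t) {x : Plane} {w : Plane → ℝ}
    (h : IsBarycentric s x w) : IsBarycentric t x w := by
  refine ⟨fun y _ => ?_, fun y hy => h.2.1 y fun hs => hy (hst hs), ?_, ?_⟩
  · by_cases hs : y ∈ s
    · exact h.1 y hs
    · rw [h.2.1 y hs]
  · rw [← h.2.2.1]
    exact (Finset.sum_subset hst fun y _ hy => h.2.1 y hy).symm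
  · rw [← h.2.2.2]
    exact (Finset.sum_subset hst fun y _ hy => by rw [h.2.1 y hy, zero_smul]).symm

namespace Triangulation

variable {Ω : Set Plane} (M : Triangulation Ω)

/-- Two faces that contain `x` meet in the hull of their common vertices. Coordinates with respect
to these serve both faces, and by affine independence each face has only one family. -/
lemma baryCoord_eq {s : Finset Plane} (hs : s ∈ M.complex.faces) {x : Plane} {w : Plane → ℝ}
    (h : IsBarycentric s x w) : M.baryCoord x = w := by
  classical
  have hex : ∃ w, ∃ s ∈ M.complex.faces, IsBarycentric s x w := ⟨w, s, hs, h⟩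
  rw [baryCoord, dif_pos hex]
  obtain ⟨t, ht, h'⟩ := hex.choose_spec
  have hx := M.complex.inter_subset_convexHull hs ht ⟨h.mem_convexHull, h'.mem_convexHull⟩
  rw [← Finset.coe_inter] at hx
  obtain ⟨w₀, h₀⟩ := exists_isBarycentric hx
  rw [(h₀.mono Finset.inter_subset_left).unique (M.complex.indep hs) h] at h₀
  exact h'.unique (M.complex.indep ht) (h₀.mono Finset.inter_subset_right)

lemma mem_triangles {T : Finset Plane} :
    T ∈ M.triangles ↔ T ∈ M.complex.faces ∧ T.card = 3 := by
  simp [triangles]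

lemma isBarycentric_baryCoord {s : Finset Plane} (hs : s ∈ M.complex.faces) {x : Plane}
    (hx : x ∈ convexHull ℝ (s : Set Plane)) : IsBarycentric s x (M.baryCoord x) := by
  obtain ⟨w, hw⟩ := exists_isBarycentric hx
  rwa [M.baryCoord_eq hs hw]

lemma hat_vertex {p : Plane} (hp : p ∈ M.complex.vertices) (q : Plane) :
    M.hat q p = if q = p then 1 else 0 := by
  classical
  have : IsBarycentric {p} p (fun y => if y = p then 1 else 0) := by
    refine ⟨by simp, by simp, by simp, by simp⟩
  rw [hat, M.baryCoord_eq hp this]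

lemma hat_eq_zero {T : Finset Plane} (hT : T ∈ M.triangles) {p x : Plane} (hp : p ∉ T)
    (hx : x ∈ convexHull ℝ (T : Set Plane)) : M.hat p x = 0 :=
  (M.isBarycentric_baryCoord (M.mem_triangles.1 hT).1 hx).2.1 p hp

lemma hat_nonneg {T : Finset Plane} (hT : T ∈ M.triangles) {x : Plane}
    (hx : x ∈ convexHull ℝ (T : Set Plane)) (p : Plane) : 0 ≤ M.hat p x := by
  by_cases hp : p ∈ T
  · exact (M.isBarycentric_baryCoord (M.mem_triangles.1 hT).1 hx).1 p hp
  · rw [M.hat_eq_zero hT hp hx]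

lemma sum_hat {T : Finset Plane} (hT : T ∈ M.triangles) {x : Plane}
    (hx : x ∈ convexHull ℝ (T : Set Plane)) : ∑ p ∈ T, M.hat p x = 1 :=
  (M.isBarycentric_baryCoord (M.mem_triangles.1 hT).1 hx).2.2.1

lemma hat_le_one {T : Finset Plane} (hT : T ∈ M.triangles) {x : Plane}
    (hx : x ∈ convexHull ℝ (T : Set Plane)) (p : Plane) : M.hat p x ≤ 1 := by
  by_cases hp : p ∈ T
  · rw [← M.sum_hat hT hx]
    exact Finset.single_le_sum (fun q _ => M.hat_nonneg hT hx q) hp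
  · rw [M.hat_eq_zero hT hp hx]; exact zero_le_one

/-- `T` is a triangle of the mesh with the distinct vertices `p`, `q`, `r`. -/
structure IsTriple (T : Finset Plane) (p q r : Plane) : Prop where
  mem : T ∈ M.triangles
  pq : p ≠ q
  pr : p ≠ r
  qr : q ≠ r
  eq : T = {p, q, r}

variable {M} in
lemma IsTriple.rotate {T : Finset Plane} {p q r : Plane} (h : M.IsTriple T p q r) :
    M.IsTriple T q r p :=
  ⟨h.mem, h.qr, h.pq.symm, h.pr.symm, by rw [h.eq]; ext y; simp; tauto⟩

variable {M} in
lemma IsTriple.swap {T : Finset Plane} {p q r : Plane} (h : M.IsTriple T p q r) :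
    M.IsTriple T p r q :=
  ⟨h.mem, h.pr, h.pq, h.qr.symm, by rw [h.eq]; ext y; simp; tauto⟩

variable {M} in
lemma IsTriple.coe_eq {T : Finset Plane} {p q r : Plane} (h : M.IsTriple T p q r) :
    (T : Set Plane) = {p, q, r} := by
  rw [h.eq]; simp

variable {M} in
lemma IsTriple.cross_ne {T : Finset Plane} {p q r : Plane} (h : M.IsTriple T p q r) :
    cross (p - q) (r - q) ≠ 0 := by
  refine cross_ne_zero h.pq h.pr h.qr ?_
  rw [← h.eq]
  exact M.complex.indep (M.mem_triangles.1 h.mem).1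

variable {M} in
lemma IsTriple.sum_eq {T : Finset Plane} {p q r : Plane} (h : M.IsTriple T p q r)
    {α : Type*} [AddCommMonoid α] (f : Plane → α) : ∑ y ∈ T, f y = f p + (f q + f r) := by
  rw [h.eq, sum_smul_eq_of_triple h.pq h.pr h.qr]

lemma exists_isTriple_of_pair {T : Finset Plane} (hT : T ∈ M.triangles) {p q : Plane} (hp : p ∈ T)
    (hq : q ∈ T) (hpq : p ≠ q) : ∃ r, M.IsTriple T p q r := by
  classical
  have hc := (M.mem_triangles.1 hT).2
  have h1 : ((T.erase p).erase q).card = 1 := by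
    rw [Finset.card_erase_of_mem (Finset.mem_erase.2 ⟨hpq.symm, hq⟩), Finset.card_erase_of_mem hp,
      hc]
  obtain ⟨r, hr⟩ := Finset.card_eq_one.1 h1
  have hm : r ∈ (T.erase p).erase q := by rw [hr]; simp
  simp only [Finset.mem_erase] at hm
  refine ⟨r, hT, hpq, hm.2.1.symm, hm.1.symm, ?_⟩
  rw [← hr, Finset.insert_erase (Finset.mem_erase.2 ⟨hpq.symm, hq⟩), Finset.insert_erase hp]

lemma exists_isTriple {T : Finset Plane} (hT : T ∈ M.triangles) {p : Plane} (hp : p ∈ T) :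
    ∃ q r, M.IsTriple T p q r := by
  have hc := (M.mem_triangles.1 hT).2
  obtain ⟨q, hq, hqp⟩ := Finset.exists_mem_ne (by omega : 1 < T.card) p
  exact ⟨q, M.exists_isTriple_of_pair hT hp hq hqp.symm⟩

lemma exists_isTriple' {T : Finset Plane} (hT : T ∈ M.triangles) :
    ∃ p q r, M.IsTriple T p q r := by
  have hc := (M.mem_triangles.1 hT).2
  obtain ⟨p, hp⟩ : T.Nonempty := Finset.card_pos.1 (by omega)
  exact ⟨p, M.exists_isTriple hT hp⟩

variable {M} in
lemma IsTriple.hat_eq {T : Finset Plane} {p q r : Plane} (h : M.IsTriple T p q r) {x : Plane}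
    (hx : x ∈ convexHull ℝ (T : Set Plane)) : M.hat p x = lam p q r x := by
  obtain ⟨-, -, h1, h2⟩ := M.isBarycentric_baryCoord (M.mem_triangles.1 h.mem).1 hx
  rw [h.sum_eq] at h1 h2
  have := lam_combination h.cross_ne (a := M.hat p x) (b := M.hat q x) (c := M.hat r x)
    (by rw [add_assoc]; exact h1)
  rw [← this]
  congr 1
  rw [add_assoc]; exact h2

/-! ### Open triangles and the constant gradients of the basis functions on them. -/

/-- The open triangle with vertex set `T`. -/
def cell (T : Finset Plane) : Set Plane := interior (convexHull ℝ (T : Set Plane))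

lemma isOpen_cell (T : Finset Plane) : IsOpen (cell T) := isOpen_interior

lemma cell_subset (T : Finset Plane) : cell T ⊆ convexHull ℝ (T : Set Plane) := interior_subset

lemma cell_ae_eq (T : Finset Plane) :
    (cell T : Set Plane) =ᵐ[volume] convexHull ℝ (T : Set Plane) :=
  interior_ae_eq_of_null_frontier ((convex_convexHull ℝ _).addHaar_frontier volume)

lemma measure_cell_lt_top (T : Finset Plane) : volume (cell T) < ⊤ :=
  (measure_mono (cell_subset T)).trans_lt
    (Set.Finite.isCompact_convexHull ℝ T.finite_toSet).measure_lt_top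

variable {M} in
lemma IsTriple.cell_nonempty {T : Finset Plane} {p q r : Plane} (h : M.IsTriple T p q r) :
    (cell T).Nonempty := by
  refine ⟨(1/3 : ℝ) • p + (1/3 : ℝ) • q + (1/3 : ℝ) • r, ?_⟩
  rw [cell, h.coe_eq]
  apply lam_pos_subset_interior h.cross_ne
  have e1 := lam_combination h.cross_ne (a := 1/3) (b := 1/3) (c := 1/3) (by norm_num)
  have e2 := lam_combination h.rotate.cross_ne (a := 1/3) (b := 1/3) (c := 1/3) (by norm_num)
  have e3 := lam_combination h.rotate.rotate.cross_ne (a := 1/3) (b := 1/3) (c := 1/3)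
    (by norm_num)
  have c2 : (1/3 : ℝ) • q + (1/3 : ℝ) • r + (1/3 : ℝ) • p =
    (1/3 : ℝ) • p + (1/3 : ℝ) • q + (1/3 : ℝ) • r := by module
  have c3 : (1/3 : ℝ) • r + (1/3 : ℝ) • p + (1/3 : ℝ) • q =
    (1/3 : ℝ) • p + (1/3 : ℝ) • q + (1/3 : ℝ) • r := by module
  rw [c2] at e2
  rw [c3] at e3
  simp only [Set.mem_ofPred_eq, e1, e2, e3]
  norm_num

variable {M} in
lemma IsTriple.hasGradientAt_hat_self {T : Finset Plane} {p q r : Plane} (h : M.IsTriple T p q r)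
    {x : Plane} (hx : x ∈ cell T) : HasGradientAt (M.hat p) (lamGrad p q r) x := by
  refine (hasGradientAt_lam p q r x).congr_of_eventuallyEq ?_
  filter_upwards [(isOpen_cell T).mem_nhds hx] with y hy
  exact h.hat_eq (cell_subset T hy)

lemma hasGradientAt_hat_zero {T : Finset Plane} (hT : T ∈ M.triangles) {p : Plane} (hp : p ∉ T)
    {x : Plane} (hx : x ∈ cell T) : HasGradientAt (M.hat p) 0 x := by
  refine (hasGradientAt_const x (0 : ℝ)).congr_of_eventuallyEq ?_
  filter_upwards [(isOpen_cell T).mem_nhds hx] with y hy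
  exact M.hat_eq_zero hT hp (cell_subset T hy)

open Classical in
/-- The constant gradient of the basis function of the node `p` on the triangle `T`. -/
def grad (T : Finset Plane) (p : Plane) : Plane :=
  if h : (cell T).Nonempty then gradient (M.hat p) h.some else 0

variable {M} in
lemma IsTriple.grad_eq {T : Finset Plane} {p q r : Plane} (h : M.IsTriple T p q r) :
    M.grad T p = lamGrad p q r := by
  rw [grad, dif_pos h.cell_nonempty]
  exact (h.hasGradientAt_hat_self h.cell_nonempty.some_mem).gradient

lemma grad_eq_zero {T : Finset Plane} (hT : T ∈ M.triangles) {p : Plane} (hp : p ∉ T) :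
    M.grad T p = 0 := by
  rw [grad]
  split_ifs with h
  · exact (M.hasGradientAt_hat_zero hT hp h.some_mem).gradient
  · rfl

lemma hasGradientAt_hat {T : Finset Plane} (hT : T ∈ M.triangles) (p : Plane)
    {x : Plane} (hx : x ∈ cell T) : HasGradientAt (M.hat p) (M.grad T p) x := by
  by_cases hp : p ∈ T
  · obtain ⟨q, r, h⟩ := M.exists_isTriple hT hp
    rw [h.grad_eq]
    exact h.hasGradientAt_hat_self hx
  · rw [M.grad_eq_zero hT hp]
    exact M.hasGradientAt_hat_zero hT hp hx

lemma sum_grad {T : Finset Plane} (hT : T ∈ M.triangles) : ∑ p ∈ T, M.grad T p = 0 := by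
  obtain ⟨p, q, r, h⟩ := M.exists_isTriple' hT
  rw [h.sum_eq, h.grad_eq, h.rotate.grad_eq, h.rotate.rotate.grad_eq, ← add_assoc, lamGrad_add]

lemma continuousOn_hat {T : Finset Plane} (hT : T ∈ M.triangles) (p : Plane) :
    ContinuousOn (M.hat p) (convexHull ℝ (T : Set Plane)) := by
  by_cases hp : p ∈ T
  · obtain ⟨q, r, h⟩ := M.exists_isTriple hT hp
    exact (continuous_lam p q r).continuousOn.congr fun x hx => h.hat_eq hx
  · exact continuousOn_const.congr fun x hx => M.hat_eq_zero hT hp hx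

/-- The area of the open triangle `T`. -/
def area (T : Finset Plane) : ℝ := volume.real (cell T)

lemma area_eq_convexHull (T : Finset Plane) :
    area T = volume.real (convexHull ℝ (T : Set Plane)) := measureReal_congr (cell_ae_eq T)

variable {M} in
lemma IsTriple.area_eq {T : Finset Plane} {p q r : Plane} (h : M.IsTriple T p q r) :
    area T = |cross (p - q) (r - q)| / 2 := by
  rw [area_eq_convexHull, h.coe_eq, measureReal_triangle h.cross_ne]

lemma area_pos {T : Finset Plane} (hT : T ∈ M.triangles) : 0 < area T := by
  obtain ⟨p, q, r, h⟩ := M.exists_isTriple' hT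
  rw [h.area_eq]
  have := abs_pos.2 h.cross_ne
  positivity

variable {M} in
lemma IsTriple.inner_grad {T : Finset Plane} {p q r : Plane} (h : M.IsTriple T p q r) :
    inner ℝ (M.grad T q) (M.grad T p) * area T = - Real.cot (EuclideanGeometry.angle p r q) / 2 := by
  rw [h.area_eq, h.grad_eq, h.rotate.grad_eq, ← inner_lamGrad h.cross_ne]
  ring

lemma setIntegral_hat {T : Finset Plane} (hT : T ∈ M.triangles) {p : Plane} (hp : p ∈ T) :
    ∫ x in cell T, M.hat p x = area T / 3 := by
  obtain ⟨q, r, h⟩ := M.exists_isTriple hT hp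
  rw [h.area_eq, setIntegral_congr_fun (isOpen_cell T).measurableSet
    (fun x hx => h.hat_eq (cell_subset T hx)), setIntegral_congr_set (cell_ae_eq T), h.coe_eq,
    setIntegral_lam h.cross_ne]
  ring

lemma setIntegral_hat_mul_hat {T : Finset Plane} (hT : T ∈ M.triangles) {p q : Plane} (hp : p ∈ T)
    (hq : q ∈ T) (hpq : p ≠ q) : ∫ x in cell T, M.hat p x * M.hat q x = area T / 12 := by
  obtain ⟨r, h⟩ := M.exists_isTriple_of_pair hT hp hq hpq
  rw [h.swap.area_eq, setIntegral_congr_fun (isOpen_cell T).measurableSet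
    (g := fun x => lam p r q x * lam q p r x) (fun x hx => by
      rw [h.swap.hat_eq (cell_subset T hx), h.rotate.swap.hat_eq (cell_subset T hx)]),
    setIntegral_congr_set (cell_ae_eq T), h.swap.coe_eq, setIntegral_lam_mul_lam h.swap.cross_ne]
  ring

/-! ### Finite element functions -/

lemma mem_vertices_of_mem {T : Finset Plane} (hT : T ∈ M.triangles) {p : Plane} (hp : p ∈ T) :
    p ∈ M.complex.vertices :=
  M.complex.down_closed (M.mem_triangles.1 hT).1 (Finset.singleton_subset_iff.2 hp)
    (Finset.singleton_nonempty p)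

lemma hat_apply_dof (p q : M.dof) : M.hat p q = if p = q then 1 else 0 := by
  rw [M.hat_vertex q.2.1]
  simp only [Subtype.ext_iff]

/-- Both sides are linear in `u`, and for a basis function the sum collapses. As `x` is any point of
the plane, agreement at the interior nodes is agreement as functions. -/
lemma eq_sum_hat {u : Plane → ℝ} (hu : u ∈ M.discreteSpace) (x : Plane) :
    u x = ∑ q : M.dof, u q * M.hat q x := by
  induction hu using Submodule.span_induction with
  | mem v hv =>
    obtain ⟨p, hp, rfl⟩ := hv
    rw [Finset.sum_eq_single ⟨p, hp⟩]
    · rw [M.hat_vertex hp.1, if_pos rfl, one_mul]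
    · intro q _ hq
      rw [M.hat_apply_dof ⟨p, hp⟩, if_neg hq.symm, zero_mul]
    · simp
  | zero => simp
  | add v w _ _ hv hw => simp [hv, hw, add_mul, Finset.sum_add_distrib]
  | smul a v _ hv => simp only [Pi.smul_apply, smul_eq_mul, hv, Finset.mul_sum, mul_assoc]

/-- A function that is affine on each triangle of the mesh. -/
def IsPiecewiseLinear (u : Plane → ℝ) : Prop :=
  ∀ T ∈ M.triangles, ∀ x ∈ convexHull ℝ (T : Set Plane), u x = ∑ p ∈ T, u p * M.hat p x

lemma isPiecewiseLinear_hat (q : Plane) : M.IsPiecewiseLinear (M.hat q) := by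
  intro T hT x hx
  have : ∀ p ∈ T, M.hat q p * M.hat p x = if q = p then M.hat q x else 0 := by
    intro p hp
    rw [M.hat_vertex (M.mem_vertices_of_mem hT hp)]
    split_ifs with h
    · rw [h, one_mul]
    · rw [zero_mul]
  rw [Finset.sum_congr rfl this, Finset.sum_ite_eq]
  split_ifs with h
  · rfl
  · exact M.hat_eq_zero hT h hx

lemma isPiecewiseLinear_of_mem {u : Plane → ℝ} (hu : u ∈ M.discreteSpace) :
    M.IsPiecewiseLinear u := by
  intro T hT x hx
  induction hu using Submodule.span_induction with
  | mem v hv =>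
    obtain ⟨q, -, rfl⟩ := hv
    exact M.isPiecewiseLinear_hat q T hT x hx
  | zero => simp
  | add v w _ _ hv hw => simp [hv, hw, add_mul, Finset.sum_add_distrib]
  | smul a v _ hv => simp only [Pi.smul_apply, smul_eq_mul, hv, Finset.mul_sum, mul_assoc]

/-- The gradient on `T` of the piecewise linear function with the nodal values of `u`. -/
def nodalGrad (T : Finset Plane) (u : Plane → ℝ) : Plane := ∑ p ∈ T, u p • M.grad T p

lemma hasGradientAt_sum_hat {T : Finset Plane} (hT : T ∈ M.triangles) (u : Plane → ℝ)
    {x : Plane} (hx : x ∈ cell T) (S : Finset Plane) :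
    HasGradientAt (fun y => ∑ p ∈ S, u p * M.hat p y) (∑ p ∈ S, u p • M.grad T p) x := by
  rw [hasGradientAt_iff_hasFDerivAt, map_sum]
  refine HasFDerivAt.fun_sum fun p _ => ?_
  rw [map_smul]
  exact (M.hasGradientAt_hat hT p hx).hasFDerivAt.const_mul (u p)

variable {M} in
lemma IsPiecewiseLinear.gradient_eq {u : Plane → ℝ} (hu : M.IsPiecewiseLinear u)
    {T : Finset Plane} (hT : T ∈ M.triangles) {x : Plane} (hx : x ∈ cell T) :
    gradient u x = M.nodalGrad T u := by
  refine HasGradientAt.gradient ?_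
  refine (M.hasGradientAt_sum_hat hT u hx T).congr_of_eventuallyEq ?_
  filter_upwards [(isOpen_cell T).mem_nhds hx] with y hy
  exact hu T hT y (cell_subset T hy)

variable {M} in
lemma IsPiecewiseLinear.continuousOn {u : Plane → ℝ} (hu : M.IsPiecewiseLinear u)
    {T : Finset Plane} (hT : T ∈ M.triangles) :
    ContinuousOn u (convexHull ℝ (T : Set Plane)) := by
  refine ContinuousOn.congr ?_ (hu T hT)
  exact continuousOn_finsetSum _ fun p _ => continuousOn_const.mul (M.continuousOn_hat hT p)

/-! ### Geometry of the mesh -/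

lemma mem_patchTriangles {p q : Plane} {T : Finset Plane} :
    T ∈ M.patchTriangles p q ↔ T ∈ M.triangles ∧ p ∈ T ∧ q ∈ T := by
  simp [patchTriangles]

/-- Twice the signed area of the triangle with vertex set `T` and the edge `pq`. -/
def orient (p q : Plane) (T : Finset Plane) : ℝ := ∑ r ∈ T, cross (p - q) (r - q)

variable {M} in
-- The summands of `p` and `q` vanish, so the sum finds the third vertex without a choice.
lemma IsTriple.orient_eq {T : Finset Plane} {p q r : Plane} (h : M.IsTriple T p q r) :
    orient p q T = cross (p - q) (r - q) := by
  rw [orient, h.sum_eq]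
  simp only [cross, PiLp.sub_apply]; ring

/-- Otherwise `r` is not a vertex of `T'`, and its basis function vanishes on `T'`. But points of
`T'` close to the midpoint of `pq` lie in `T` and have a positive coordinate at `r`. -/
lemma eq_of_same_side {p q r s : Plane} {T T' : Finset Plane} (h : M.IsTriple T p q r)
    (h' : M.IsTriple T' p q s) (hs : 0 < cross (p - q) (r - q) * cross (p - q) (s - q)) :
    T = T' := by
  by_contra hne
  have hr : r ∉ T' := by
    intro hr
    rw [h'.eq] at hr
    simp only [Finset.mem_insert, Finset.mem_singleton] at hr
    rcases hr with rfl | rfl | rfl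
    · exact h.pr rfl
    · exact h.qr rfl
    · exact hne (h.eq.trans h'.eq.symm)
  -- A path in `T'` from the midpoint of `pq` towards `s`; by continuity its coordinates at `p` and
  -- `q` in `T` stay positive for small `e`.
  set z : ℝ → Plane := fun e => ((1 - e) / 2) • p + ((1 - e) / 2) • q + e • s with hz
  have hzT' : ∀ e ∈ Set.Ioo (0 : ℝ) 1, z e ∈ convexHull ℝ (T' : Set Plane) := by
    intro e he
    have hsum : (1 - e) / 2 + (1 - e) / 2 + e = 1 := by ring
    rw [h'.coe_eq, convexHull_triple h'.cross_ne]
    refine ⟨?_, ?_, ?_⟩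
    · rw [hz, lam_combination h'.cross_ne hsum]; linarith [he.2]
    · have : z e = ((1 - e) / 2) • q + e • s + ((1 - e) / 2) • p := by simp only [hz]; module
      rw [this, lam_combination h'.rotate.cross_ne (by linarith)]; linarith [he.2]
    · have : z e = e • s + ((1 - e) / 2) • p + ((1 - e) / 2) • q := by simp only [hz]; module
      rw [this, lam_combination h'.rotate.rotate.cross_ne (by linarith)]; exact he.1.le
  have hcont : Continuous z := by fun_prop
  have hp0 : 0 < lam p q r (z 0) := by
    have : z 0 = (1 / 2 : ℝ) • p + (1 / 2 : ℝ) • q + (0 : ℝ) • r := by simp [hz]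
    rw [this, lam_combination h.cross_ne (by norm_num)]; norm_num
  have hq0 : 0 < lam q r p (z 0) := by
    have : z 0 = (1 / 2 : ℝ) • q + (0 : ℝ) • r + (1 / 2 : ℝ) • p := by
      simp only [hz]; module
    rw [this, lam_combination h.rotate.cross_ne (by norm_num)]; norm_num
  have hr0 : ∀ e, lam r p q (z e) = e * (cross (p - q) (s - q) / cross (p - q) (r - q)) := by
    intro e
    have hne := h.rotate.rotate.cross_ne
    have h2 : cross (r - p) (q - p) = cross (p - q) (r - q) := by
      simp only [cross, PiLp.sub_apply]; ring
    rw [lam, h2, mul_div_assoc']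
    congr 1
    simp only [hz, cross, PiLp.sub_apply, PiLp.add_apply, PiLp.smul_apply, smul_eq_mul]
    ring
  have hev : ∀ᶠ e in nhdsWithin (0 : ℝ) (Set.Ioi 0),
      e ∈ Set.Ioo (0 : ℝ) 1 ∧ 0 < lam p q r (z e) ∧ 0 < lam q r p (z e) := by
    refine Filter.Eventually.and (Ioo_mem_nhdsGT one_pos)
      (Filter.Eventually.filter_mono nhdsWithin_le_nhds ?_)
    exact Filter.Eventually.and ((isOpen_lt continuous_const ((continuous_lam p q r).comp hcont)).mem_nhds hp0)
      ((isOpen_lt continuous_const ((continuous_lam q r p).comp hcont)).mem_nhds hq0)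
  obtain ⟨e, he, h1, h2⟩ := hev.exists
  have h3 : 0 < lam r p q (z e) := by
    rw [hr0]
    refine mul_pos he.1 ?_
    rw [← mul_div_mul_left _ _ h.cross_ne]
    exact div_pos hs (mul_self_pos.2 h.cross_ne)
  have hzT : z e ∈ convexHull ℝ (T : Set Plane) := by
    rw [h.coe_eq, convexHull_triple h.cross_ne]
    exact ⟨h1.le, h2.le, h3.le⟩
  rw [← h.rotate.rotate.hat_eq hzT, M.hat_eq_zero h'.mem hr (hzT' e he)] at h3
  exact h3.false

/-- An edge belongs to at most two triangles. -/
lemma card_patchTriangles_le {p q : Plane} (hpq : p ≠ q) : (M.patchTriangles p q).card ≤ 2 := by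
  classical
  have : (M.patchTriangles p q).card ≤ (Finset.univ : Finset Bool).card := by
    -- A triangle on the edge is determined by the side of the line `pq` on which it lies.
    refine Finset.card_le_card_of_injOn (fun T => decide (0 < orient p q T))
      (fun _ _ => Finset.mem_coe.2 (Finset.mem_univ _)) ?_
    intro T hT T' hT' heq
    obtain ⟨hT, hp, hq⟩ := M.mem_patchTriangles.1 hT
    obtain ⟨hT', hp', hq'⟩ := M.mem_patchTriangles.1 hT'
    obtain ⟨r, h⟩ := M.exists_isTriple_of_pair hT hp hq hpq
    obtain ⟨s, h'⟩ := M.exists_isTriple_of_pair hT' hp' hq' hpq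
    refine M.eq_of_same_side h h' ?_
    simp only [decide_eq_decide, h.orient_eq, h'.orient_eq] at heq
    rcases lt_or_gt_of_ne h.cross_ne with h1 | h1
    · rcases lt_or_gt_of_ne h'.cross_ne with h2 | h2
      · exact mul_pos_of_neg_of_neg h1 h2
      · exact absurd (heq.2 h2) h1.le.not_gt
    · exact mul_pos h1 (heq.1 h1)
  simpa using this

lemma mem_of_mem_convexHull {T : Finset Plane} (hT : T ∈ M.triangles) {p : Plane}
    (hp : p ∈ M.complex.vertices) (hpT : p ∈ convexHull ℝ (T : Set Plane)) : p ∈ T := by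
  by_contra h
  have h1 := M.hat_eq_zero hT h hpT
  rw [M.hat_vertex hp, if_pos rfl] at h1
  exact one_ne_zero h1

lemma vertices_subset : M.complex.vertices ⊆ closure Ω := by
  rw [← M.space_eq]
  exact M.complex.vertices_subset_space

lemma dof_subset : M.dof ⊆ Ω := by
  intro p hp
  by_contra h
  exact hp.2 ⟨M.vertices_subset hp.1, by rwa [M.isOpen.interior_eq]⟩

lemma exists_triangle_of_mem {x : Plane} (hx : x ∈ closure Ω) :
    ∃ T ∈ M.triangles, x ∈ convexHull ℝ (T : Set Plane) := by
  rw [← M.space_eq, Geometry.SimplicialComplex.mem_space_iff] at hx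
  obtain ⟨s, hs, hx⟩ := hx
  obtain ⟨T, hT, hsT, hc⟩ := M.pure s hs
  exact ⟨T, M.mem_triangles.2 ⟨hT, hc⟩, convexHull_mono (by exact_mod_cast hsT) hx⟩

lemma convexHull_subset_closure {T : Finset Plane} (hT : T ∈ M.triangles) :
    convexHull ℝ (T : Set Plane) ⊆ closure Ω := by
  rw [← M.space_eq]
  exact M.complex.convexHull_subset_space (M.mem_triangles.1 hT).1

lemma isClosed_convexHull (T : Finset Plane) : IsClosed (convexHull ℝ (T : Set Plane)) :=
  (Set.Finite.isCompact_convexHull ℝ T.finite_toSet).isClosed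

/-- Every nonempty set of interior nodes has a neighbour outside of it. -/
lemma exists_neighbour_notMem {N : Set Plane} (hN : N ⊆ M.dof) (hne : N.Nonempty) :
    ∃ x ∈ N, ∃ T ∈ M.triangles, x ∈ T ∧ ∃ y ∈ T, y ∉ N := by
  classical
  have hfin : N.Finite := (Set.toFinite M.dof).subset hN
  -- Take a rightmost node of `N`. A short step to its right stays in `Ω` and avoids the triangles
  -- that miss `x`, so it lands in a triangle with vertex `x`. Were all vertices of it in `N`, the
  -- triangle could not extend to the right of `x`.
  obtain ⟨x, hxN, hmax⟩ := Set.exists_max_image N (fun y => y 0) hfin hne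
  refine ⟨x, hxN, ?_⟩
  set F : Finset (Finset Plane) := {T ∈ M.triangles | x ∉ convexHull ℝ (T : Set Plane)} with hF
  set U : Set Plane := Ω ∩ ⋂ T ∈ F, (convexHull ℝ (T : Set Plane))ᶜ with hU
  have hUo : IsOpen U := M.isOpen.inter
    (isOpen_biInter_finset fun T _ => (isClosed_convexHull T).isOpen_compl)
  have hxU : x ∈ U := by
    refine ⟨M.dof_subset (hN hxN), ?_⟩
    simp [hF]
  have hcont : Continuous fun t : ℝ => x + t • (EuclideanSpace.single 0 1 : Plane) := by fun_prop
  have hev : ∀ᶠ t in nhdsWithin (0 : ℝ) (Set.Ioi 0),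
      t ∈ Set.Ioi (0 : ℝ) ∧ x + t • (EuclideanSpace.single 0 1 : Plane) ∈ U :=
    Filter.Eventually.and self_mem_nhdsWithin <| nhdsWithin_le_nhds <|
      (hUo.preimage hcont).mem_nhds (by simpa using hxU)
  obtain ⟨t, ht, htU⟩ := hev.exists
  obtain ⟨T, hT, htT⟩ := M.exists_triangle_of_mem (subset_closure htU.1)
  have hxT : x ∈ convexHull ℝ (T : Set Plane) := by
    by_contra h
    have := Set.mem_iInter₂.1 htU.2 T (by simp [hF, hT, h])
    exact this htT
  refine ⟨T, hT, M.mem_of_mem_convexHull hT (hN hxN).1 hxT, ?_⟩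
  by_contra! hall
  have hsub : convexHull ℝ (T : Set Plane) ⊆ {y | y 0 ≤ x 0} := by
    refine convexHull_min (fun y hy => hmax y (hall y hy)) ?_
    exact convex_halfSpace_le (EuclideanSpace.proj (𝕜 := ℝ) (0 : Fin 2)).toLinearMap.isLinear _
  have := hsub htT
  simp at this
  exact absurd ht (not_lt.2 this)

/-! ### Decomposition of integrals -/

/-- The boundary of an open set has empty interior, so the finitely many simplices inside it that
cover it have empty interior. Such a closed convex set is its own frontier, which is null. -/
lemma measure_frontier (M : Triangulation Ω) : volume (frontier Ω) = 0 := by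
  have hint : interior (frontier Ω) = ∅ := by
    rw [← frontier_compl]
    exact interior_frontier M.isOpen.isClosed_compl
  have hsub : frontier Ω ⊆ ⋃ e ∈ {e ∈ M.complex.faces |
      convexHull ℝ (e : Set Plane) ⊆ frontier Ω}, convexHull ℝ (e : Set Plane) := by
    intro x hx
    obtain ⟨e, he, -, hxe, hsub⟩ := M.boundary x hx
    exact Set.mem_biUnion (show e ∈ {e ∈ M.complex.faces | _} from ⟨he, hsub⟩) hxe
  refine measure_mono_null hsub ((measure_biUnion_null_iff
    (M.finite.subset (Set.sep_subset _ _)).countable).2 ?_)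
  rintro e ⟨-, he⟩
  have : interior (convexHull ℝ (e : Set Plane)) = ∅ :=
    Set.subset_eq_empty (interior_mono he) hint
  have h2 := (convex_convexHull ℝ (e : Set Plane)).addHaar_frontier volume
  rwa [frontier, (isClosed_convexHull e).closure_eq, this, Set.sdiff_empty] at h2

lemma closure_ae_eq (M : Triangulation Ω) : (closure Ω : Set Plane) =ᵐ[volume] Ω :=
  (closure_ae_eq_of_null_frontier M.measure_frontier)

/-- At a common point, the basis function of a vertex `p` of `T` outside `T'` would have zero
gradient, and then `lam p q r` would vanish at `p`, where it is one. -/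
lemma disjoint_cell {T T' : Finset Plane} (hT : T ∈ M.triangles) (hT' : T' ∈ M.triangles)
    (hne : T ≠ T') : Disjoint (cell T) (cell T') := by
  obtain ⟨p, hp, hp'⟩ : ∃ p ∈ T, p ∉ T' := by
    by_contra! h
    exact hne (Finset.eq_of_subset_of_card_le h
      (by rw [(M.mem_triangles.1 hT).2, (M.mem_triangles.1 hT').2]))
  rw [Set.disjoint_left]
  intro x hx hx'
  obtain ⟨q, r, h⟩ := M.exists_isTriple hT hp
  have h1 := (h.hasGradientAt_hat_self hx).gradient
  rw [(M.hasGradientAt_hat_zero hT' hp' hx').gradient] at h1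
  have h2 := h.cross_ne
  have h3 : lam p q r p = 1 := by rw [lam, div_self h2]
  rw [lam_eq_inner, ← h1] at h3
  simp at h3

lemma iUnion_cell_ae_eq (S : Finset (Finset Plane)) :
    (⋃ T ∈ S, cell T : Set Plane) =ᵐ[volume] ⋃ T ∈ S, convexHull ℝ (T : Set Plane) :=
  Filter.EventuallyEq.countable_bUnion S.countable_toSet fun T _ => cell_ae_eq T

lemma domain_ae_eq (M : Triangulation Ω) : Ω =ᵐ[volume] (⋃ T ∈ M.triangles, cell T : Set Plane) := by
  refine M.closure_ae_eq.symm.trans (Filter.EventuallyEq.trans (Filter.EventuallyEq.of_eq ?_)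
    (iUnion_cell_ae_eq M.triangles).symm)
  refine Set.Subset.antisymm (fun x hx => ?_) (Set.iUnion₂_subset fun T hT =>
    M.convexHull_subset_closure hT)
  obtain ⟨T, hT, hx⟩ := M.exists_triangle_of_mem hx
  exact Set.mem_biUnion hT hx

lemma restrict_cell_le {T : Finset Plane} (hT : T ∈ M.triangles) :
    volume.restrict (cell T) ≤ volume.restrict Ω := by
  rw [← Measure.restrict_congr_set M.closure_ae_eq]
  exact Measure.restrict_mono ((cell_subset T).trans (M.convexHull_subset_closure hT)) le_rfl

lemma setIntegral_iUnion_cell {S : Finset (Finset Plane)} (hS : S ⊆ M.triangles) {F : Plane → ℝ}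
    (hF : ∀ T ∈ S, IntegrableOn F (cell T)) :
    ∫ x in ⋃ T ∈ S, cell T, F x = ∑ T ∈ S, ∫ x in cell T, F x :=
  integral_biUnion_finset S (fun T _ => (isOpen_cell T).measurableSet)
    (fun _ hT _ hT' hne => M.disjoint_cell (hS hT) (hS hT') hne) hF

lemma setIntegral_patch (p q : Plane) {F : Plane → ℝ}
    (hF : ∀ T ∈ M.patchTriangles p q, IntegrableOn F (cell T)) :
    ∫ x in M.patch p q, F x = ∑ T ∈ M.patchTriangles p q, ∫ x in cell T, F x := by
  rw [patch, ← setIntegral_congr_set (iUnion_cell_ae_eq _)]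
  exact M.setIntegral_iUnion_cell (fun T hT => (M.mem_patchTriangles.1 hT).1) hF

lemma setIntegral_domain {F : Plane → ℝ} (hF : IntegrableOn F Ω) :
    ∫ x in Ω, F x = ∑ T ∈ M.triangles, ∫ x in cell T, F x := by
  rw [setIntegral_congr_set M.domain_ae_eq]
  exact M.setIntegral_iUnion_cell (Finset.Subset.refl _)
    fun T hT => Integrable.mono_measure hF (M.restrict_cell_le hT)

end Triangulation

/-! ### Carathéodory functions -/

section Caratheodory

variable {α : Type*} [MeasurableSpace α] {μ : Measure α} {h : α → ℝ → ℝ} {u : α → ℝ}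

lemma aemeasurable_comp_simpleFunc (hm : ∀ η, AEMeasurable (fun x => h x η) μ)
    (s : SimpleFunc α ℝ) : AEMeasurable (fun x => h x (s x)) μ := by
  have : (fun x => h x (s x)) =
      fun x => ∑ c ∈ s.range, (s ⁻¹' {c}).indicator (fun x => h x c) x := by
    ext x
    rw [Finset.sum_eq_single (s x)]
    · rw [Set.indicator_of_mem (by simp)]
    · intro c _ hc
      exact Set.indicator_of_notMem (by simpa using hc.symm) _
    · intro hx
      exact absurd (s.mem_range_self x) hx
  rw [this]
  exact Finset.aemeasurable_fun_sum _ fun c _ => (hm c).indicator (s.measurableSet_fiber c)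

/-- Approximate `u` by simple functions and pass to the limit by continuity in the second argument.
-/
lemma aemeasurable_caratheodory (hm : ∀ η, AEMeasurable (fun x => h x η) μ)
    (hc : ∀ᵐ x ∂μ, Continuous (h x)) (hu : AEMeasurable u μ) :
    AEMeasurable (fun x => h x (u x)) μ := by
  have hs := hu.measurable_mk.stronglyMeasurable
  have key : AEMeasurable (fun x => h x (hu.mk u x)) μ := by
    refine aemeasurable_of_tendsto_metrizable_ae Filter.atTop
      (fun n => aemeasurable_comp_simpleFunc hm (hs.approx n)) ?_
    filter_upwards [hc] with x hx
    exact (hx.tendsto _).comp (hs.tendsto_approx x)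
  refine key.congr ?_
  filter_upwards [hu.ae_eq_mk] with x hx
  rw [hx]

/-- The derivative is the limit of difference quotients with steps `1/(n+1)`, each measurable by the
previous lemma. -/
lemma aemeasurable_deriv_caratheodory (hm : ∀ η, AEMeasurable (fun x => h x η) μ)
    (hc : ∀ᵐ x ∂μ, ContDiff ℝ 1 (h x)) (hu : AEMeasurable u μ) :
    AEMeasurable (fun x => deriv (h x) (u x)) μ := by
  have hcont : ∀ᵐ x ∂μ, Continuous (h x) := hc.mono fun x hx => hx.continuous
  refine aemeasurable_of_tendsto_metrizable_ae Filter.atTop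
    (f := fun (n : ℕ) x => (1 / ((n : ℝ) + 1))⁻¹ • (h x (u x + 1 / ((n : ℝ) + 1)) - h x (u x)))
    (fun n => ?_) ?_
  · exact ((aemeasurable_caratheodory hm hcont (hu.add_const _)).sub
      (aemeasurable_caratheodory hm hcont hu)).const_smul (1 / ((n : ℝ) + 1))⁻¹
  · filter_upwards [hc] with x hx
    have hd := ((hx.differentiable one_ne_zero) (u x)).hasDerivAt.tendsto_slope_zero
    refine hd.comp (tendsto_nhdsWithin_iff.2 ⟨tendsto_one_div_add_atTop_nhds_zero_nat, ?_⟩)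
    exact Filter.Eventually.of_forall fun n => (Nat.one_div_pos_of_nat).ne'

end Caratheodory

/-! ### The averaged derivative. -/

section MeanDeriv

variable {h : Plane → ℝ → ℝ} {u₁ u₂ : Plane → ℝ}

/-- The fundamental theorem of calculus on the segment from `u₂ x` to `u₁ x`; it makes the
linearization exact. -/
lemma meanDeriv_mul_sub {x : Plane} (hx : ContDiff ℝ 1 (h x)) :
    meanDeriv h u₁ u₂ x * (u₁ x - u₂ x) = h x (u₁ x) - h x (u₂ x) := by
  have hd : ∀ t ∈ Set.uIcc (0 : ℝ) 1, HasDerivAt (fun t => h x (t * u₁ x + (1 - t) * u₂ x))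
      (deriv (h x) (t * u₁ x + (1 - t) * u₂ x) * (u₁ x - u₂ x)) t := by
    intro t _
    have h1 : HasDerivAt (fun t : ℝ => t * u₁ x + (1 - t) * u₂ x) (u₁ x - u₂ x) t := by
      have := ((hasDerivAt_id t).mul_const (u₁ x)).add
        (((hasDerivAt_id t).const_sub 1).mul_const (u₂ x))
      rw [show u₁ x - u₂ x = 1 * u₁ x + -1 * u₂ x by ring]
      exact this
    exact ((hx.differentiable one_ne_zero) _).hasDerivAt.comp t h1
  have hcd : Continuous (deriv (h x)) := hx.continuous_deriv le_rfl
  rw [meanDeriv, ← intervalIntegral.integral_mul_const,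
    intervalIntegral.integral_eq_sub_of_hasDerivAt hd
      (Continuous.intervalIntegrable (by fun_prop) _ _)]
  simp

lemma meanDeriv_of_eq {x : Plane} (hx : u₁ x = u₂ x) :
    meanDeriv h u₁ u₂ x = deriv (h x) (u₁ x) := by
  have : ∀ t : ℝ, t * u₂ x + (1 - t) * u₂ x = u₂ x := fun t => by ring
  simp [meanDeriv, hx, this]

lemma aemeasurable_meanDeriv {μ : Measure Plane} (hm : ∀ η, AEMeasurable (fun x => h x η) μ)
    (hc : ∀ᵐ x ∂μ, ContDiff ℝ 1 (h x)) (h₁ : AEMeasurable u₁ μ) (h₂ : AEMeasurable u₂ μ) :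
    AEMeasurable (meanDeriv h u₁ u₂) μ := by
  have hcont : ∀ᵐ x ∂μ, Continuous (h x) := hc.mono fun x hx => hx.continuous
  -- The average is the difference quotient where `u₁ ≠ u₂`. Elsewhere the quotient is `0 / 0 = 0`,
  -- and the indicator supplies the derivative. Joint measurability in `x` and `t` is thus avoided.
  have hq : AEMeasurable (fun x => (h x (u₁ x) - h x (u₂ x)) / (u₁ x - u₂ x) +
      {x | u₁ x = u₂ x}.indicator (fun x => deriv (h x) (u₁ x)) x) μ :=
    (((aemeasurable_caratheodory hm hcont h₁).sub (aemeasurable_caratheodory hm hcont h₂)).div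
      (h₁.sub h₂)).add
      ((aemeasurable_deriv_caratheodory hm hc h₁).indicator₀ (nullMeasurableSet_eq_fun h₁ h₂))
  refine hq.congr ?_
  filter_upwards [hc] with x hx
  by_cases hxe : u₁ x = u₂ x
  · have hmem : x ∈ {x | u₁ x = u₂ x} := hxe
    rw [Set.indicator_of_mem hmem, meanDeriv_of_eq hxe, hxe]
    simp
  · have hmem : x ∉ {x | u₁ x = u₂ x} := hxe
    rw [Set.indicator_of_notMem hmem, ← meanDeriv_mul_sub hx,
      mul_div_cancel_right₀ _ (sub_ne_zero.2 hxe), add_zero]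

lemma abs_meanDeriv_le {K : ℝ} {x : Plane} (hx : ∀ η, |deriv (h x) η| ≤ K) :
    |meanDeriv h u₁ u₂ x| ≤ K := by
  have := intervalIntegral.norm_integral_le_of_norm_le_const (a := 0) (b := 1)
    (f := fun t : ℝ => deriv (h x) (t * u₁ x + (1 - t) * u₂ x)) (C := K) fun t _ => hx _
  rw [meanDeriv, ← Real.norm_eq_abs]
  simpa only [sub_zero, abs_one, mul_one] using this

lemma meanDeriv_nonneg {x : Plane} (hx : ∀ η, 0 ≤ deriv (h x) η) : 0 ≤ meanDeriv h u₁ u₂ x :=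
  intervalIntegral.integral_nonneg zero_le_one fun _ _ => hx _

end MeanDeriv

/-! ### Monotone matrices -/

/-- A matrix with nonpositive off-diagonal entries whose columns, completed by the entries of the
boundary nodes, have nonnegative sums, is monotone if every set of interior indices is linked to its
complement by a negative entry. -/
lemma monotoneMatrix_of_columns {α : Type*} (V : Finset α) (D : Set α) [Fintype D]
    (hD : ∀ j ∈ D, j ∈ V) (a : α → α → ℝ) (hoff : ∀ p ∈ V, ∀ j ∈ D, p ≠ j → a p j ≤ 0)
    (hcol : ∀ j ∈ D, 0 ≤ ∑ p ∈ V, a p j)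
    (hexit : ∀ N ⊆ D, N.Nonempty → ∃ j ∈ N, ∃ p ∈ V, p ∉ N ∧ a p j < 0) :
    MonotoneMatrix (fun i j : D => a i j) := by
  classical
  intro v hv
  by_contra hneg
  set N : Finset D := {j | v j < 0} with hN
  have hmem : ∀ j, j ∈ N ↔ v j < 0 := fun j => by simp [hN]
  have hNne : N.Nonempty := by
    by_contra h
    rw [Finset.not_nonempty_iff_eq_empty] at h
    refine hneg fun j => ?_
    by_contra hj
    have : j ∈ N := (hmem j).2 (not_le.1 hj)
    simp [h] at this
  set N' : Finset α := N.map ⟨Subtype.val, Subtype.val_injective⟩ with hN'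
  have hN'V : N' ⊆ V := by
    intro p hp
    obtain ⟨j, -, rfl⟩ := Finset.mem_map.1 hp
    exact hD _ j.2
  -- The part of column `j` in the rows of `N` is a nonnegative column sum minus nonpositive
  -- entries.
  have hs : ∀ j : D, ∑ i ∈ N, a i j = ∑ p ∈ V, a p j - ∑ p ∈ V \ N', a p j := by
    intro j
    rw [← Finset.sum_sdiff hN'V, add_sub_cancel_left, hN', Finset.sum_map]
    rfl
  have hout : ∀ j ∈ N, ∀ p ∈ V \ N', a p j ≤ 0 := by
    intro j hj p hp
    refine hoff p (Finset.mem_sdiff.1 hp).1 j j.2 fun h => (Finset.mem_sdiff.1 hp).2 ?_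
    rw [h]
    exact Finset.mem_map_of_mem _ hj
  have hterm : ∀ j : D, (∑ i ∈ N, a i j) * v j ≤ 0 := by
    intro j
    by_cases hj : j ∈ N
    · refine mul_nonpos_of_nonneg_of_nonpos ?_ ((hmem j).1 hj).le
      rw [hs]
      linarith [hcol j j.2, Finset.sum_nonpos (hout j hj)]
    · refine mul_nonpos_of_nonpos_of_nonneg ?_ (not_lt.1 fun h => hj ((hmem j).2 h))
      refine Finset.sum_nonpos fun i hi => hoff i (hD _ i.2) j j.2 fun h => hj ?_
      rwa [← Subtype.ext h]
  -- The link from `N` to its complement, possibly to a boundary node, makes one term strictly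
  -- negative.
  obtain ⟨j, hj, p, hpV, hpN, hap⟩ := hexit (N' : Set α) (by
    intro p hp
    obtain ⟨j, -, rfl⟩ := Finset.mem_map.1 (Finset.mem_coe.1 hp)
    exact j.2) (by simpa [hN'] using hNne)
  obtain ⟨j, hjN, rfl⟩ := Finset.mem_map.1 (Finset.mem_coe.1 hj)
  have hlt : (∑ i ∈ N, a i j) * v j < 0 := by
    refine mul_neg_of_pos_of_neg ?_ ((hmem j).1 hjN)
    rw [hs]
    have : ∑ p ∈ V \ N', a p j < 0 :=
      Finset.sum_neg' (hout j hjN) ⟨p, Finset.mem_sdiff.2 ⟨hpV, fun h => hpN (by simpa using h)⟩, hap⟩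
    linarith [hcol j j.2]
  have hsum : ∑ j : D, (∑ i ∈ N, a i j) * v j < 0 :=
    Finset.sum_neg' (fun j _ => hterm j) ⟨j, Finset.mem_univ _, hlt⟩
  -- Adding the rows of `A v ≥ 0` indexed by `N` and exchanging the sums contradicts `hsum`.
  have hpos : 0 ≤ ∑ i ∈ N, Matrix.mulVec (fun i j : D => a i j) v i :=
    Finset.sum_nonneg fun i _ => hv i
  simp only [Matrix.mulVec, dotProduct] at hpos
  rw [Finset.sum_comm] at hpos
  simp only [← Finset.sum_mul] at hpos
  exact hsum.not_ge hpos

namespace Triangulation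

variable {Ω : Set Plane} (M : Triangulation Ω)

/-! ### Element matrices -/

/-- Bounds for the coefficients `k`, `b`, `c` of the linearized form on the measure space `μ`. -/
structure CoeffBounds (μ : Measure Plane) (k b c : Plane → ℝ) (kα kβ Kη Gη : ℝ) : Prop where
  k_meas : AEStronglyMeasurable k μ
  b_meas : AEStronglyMeasurable b μ
  c_meas : AEStronglyMeasurable c μ
  k_bounds : ∀ᵐ x ∂μ, kα ≤ k x ∧ k x ≤ kβ
  b_bounds : ∀ᵐ x ∂μ, |b x| ≤ Kη
  c_bounds : ∀ᵐ x ∂μ, 0 ≤ c x ∧ c x ≤ Gη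

/-- The contribution of the triangle `T` to the entry `(p, q)` of the linearized matrix. -/
def localEntry (k b c u : Plane → ℝ) (T : Finset Plane) (p q : Plane) : ℝ :=
  (∫ x in cell T, k x) * inner ℝ (M.grad T q) (M.grad T p) +
  (∫ x in cell T, b x * M.hat q x) * inner ℝ (M.nodalGrad T u) (M.grad T p) +
  ∫ x in cell T, c x * M.hat q x * M.hat p x

instance (T : Finset Plane) : IsFiniteMeasure (volume.restrict (cell T)) :=
  isFiniteMeasure_restrict.2 (measure_cell_lt_top T).ne

lemma aestronglyMeasurable_hat {T : Finset Plane} (hT : T ∈ M.triangles) (p : Plane) :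
    AEStronglyMeasurable (M.hat p) (volume.restrict (cell T)) :=
  ((M.continuousOn_hat hT p).mono (cell_subset T)).aestronglyMeasurable
    (isOpen_cell T).measurableSet

lemma ae_mem_cell (T : Finset Plane) : ∀ᵐ x ∂(volume.restrict (cell T)), x ∈ cell T :=
  ae_restrict_mem (isOpen_cell T).measurableSet

lemma abs_hat_le {T : Finset Plane} (hT : T ∈ M.triangles) (p : Plane) {x : Plane}
    (hx : x ∈ cell T) : |M.hat p x| ≤ 1 := by
  rw [abs_of_nonneg (M.hat_nonneg hT (cell_subset T hx) p)]
  exact M.hat_le_one hT (cell_subset T hx) p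

lemma integrableOn_hat {T : Finset Plane} (hT : T ∈ M.triangles) (p : Plane) :
    IntegrableOn (M.hat p) (cell T) := by
  refine Integrable.of_bound (M.aestronglyMeasurable_hat hT p) 1 ?_
  filter_upwards [ae_mem_cell T] with x hx using M.abs_hat_le hT p hx

lemma integrableOn_mul_hat {T : Finset Plane} (hT : T ∈ M.triangles) {f : Plane → ℝ}
    (hf : IntegrableOn f (cell T)) (p : Plane) :
    IntegrableOn (fun x => f x * M.hat p x) (cell T) := by
  refine Integrable.mono hf (hf.aestronglyMeasurable.mul (M.aestronglyMeasurable_hat hT p)) ?_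
  filter_upwards [ae_mem_cell T] with x hx
  rw [norm_mul]
  exact mul_le_of_le_one_right (norm_nonneg _) (M.abs_hat_le hT p hx)

section Bounds

variable {M} {T : Finset Plane} {k b c u : Plane → ℝ} {kα kβ Kη Gη : ℝ}

lemma CoeffBounds.k_integrable (h : CoeffBounds (volume.restrict (cell T)) k b c kα kβ Kη Gη) :
    IntegrableOn k (cell T) := by
  refine Integrable.of_bound h.k_meas (max |kα| |kβ|) ?_
  filter_upwards [h.k_bounds] with x hx
  exact abs_le_max_abs_abs hx.1 hx.2

lemma CoeffBounds.b_integrable (h : CoeffBounds (volume.restrict (cell T)) k b c kα kβ Kη Gη) :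
    IntegrableOn b (cell T) :=
  Integrable.of_bound h.b_meas Kη h.b_bounds

lemma CoeffBounds.c_integrable (h : CoeffBounds (volume.restrict (cell T)) k b c kα kβ Kη Gη) :
    IntegrableOn c (cell T) := by
  refine Integrable.of_bound h.c_meas Gη ?_
  filter_upwards [h.c_bounds] with x hx
  rw [Real.norm_eq_abs, abs_of_nonneg hx.1]
  exact hx.2

/-- An open triangle has positive measure, so the bounds on `c` hold at some point. -/
lemma CoeffBounds.bound_nonneg (h : CoeffBounds (volume.restrict (cell T)) k b c kα kβ Kη Gη)
    (hT : T ∈ M.triangles) : 0 ≤ Gη := by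
  have hne : (ae (volume.restrict (cell T))).NeBot := by
    rw [ae_neBot, Ne, Measure.restrict_eq_zero]
    intro h0
    have := M.area_pos hT
    rw [area, measureReal_def, h0] at this
    simp at this
  obtain ⟨x, hx⟩ := h.c_bounds.exists
  exact hx.1.trans hx.2

lemma CoeffBounds.le_integral_k (h : CoeffBounds (volume.restrict (cell T)) k b c kα kβ Kη Gη) :
    kα * area T ≤ ∫ x in cell T, k x := by
  have : ∫ _ in cell T, kα = kα * area T := by
    rw [setIntegral_const, smul_eq_mul, mul_comm]; rfl
  rw [← this]
  exact integral_mono_ae (integrable_const _) h.k_integrable (h.k_bounds.mono fun x hx => hx.1)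

lemma CoeffBounds.abs_integral_b_le
    (h : CoeffBounds (volume.restrict (cell T)) k b c kα kβ Kη Gη) (hT : T ∈ M.triangles)
    {q : Plane} (hq : q ∈ T) : |∫ x in cell T, b x * M.hat q x| ≤ Kη * area T / 3 := by
  rw [mul_div_assoc, ← M.setIntegral_hat hT hq, ← integral_const_mul, ← Real.norm_eq_abs]
  refine norm_integral_le_of_norm_le ((M.integrableOn_hat hT q).const_mul Kη) ?_
  filter_upwards [h.b_bounds, ae_mem_cell T] with x hx hxT
  have h0 := M.hat_nonneg hT (cell_subset T hxT) q
  rw [Real.norm_eq_abs, abs_mul, abs_of_nonneg h0]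
  exact mul_le_mul_of_nonneg_right hx h0

lemma CoeffBounds.integral_c_le
    (h : CoeffBounds (volume.restrict (cell T)) k b c kα kβ Kη Gη) (hT : T ∈ M.triangles)
    {p q : Plane} (hp : p ∈ T) (hq : q ∈ T) (hpq : p ≠ q) :
    ∫ x in cell T, c x * M.hat q x * M.hat p x ≤ Gη * area T / 12 := by
  rw [mul_div_assoc, ← M.setIntegral_hat_mul_hat hT hq hp hpq.symm, ← integral_const_mul]
  refine integral_mono_ae
    (M.integrableOn_mul_hat hT (M.integrableOn_mul_hat hT h.c_integrable q) p)
    ((M.integrableOn_mul_hat hT (M.integrableOn_hat hT q) p).const_mul Gη) ?_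
  filter_upwards [h.c_bounds, ae_mem_cell T] with x hx hxT
  rw [mul_assoc]
  exact mul_le_mul_of_nonneg_right hx.2 (mul_nonneg (M.hat_nonneg hT (cell_subset T hxT) q)
    (M.hat_nonneg hT (cell_subset T hxT) p))

lemma CoeffBounds.integral_c_nonneg
    (h : CoeffBounds (volume.restrict (cell T)) k b c kα kβ Kη Gη) (hT : T ∈ M.triangles)
    (p q : Plane) : 0 ≤ ∫ x in cell T, c x * M.hat q x * M.hat p x := by
  refine integral_nonneg_of_ae ?_
  filter_upwards [h.c_bounds, ae_mem_cell T] with x hx hxT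
  exact mul_nonneg (mul_nonneg hx.1 (M.hat_nonneg hT (cell_subset T hxT) q))
    (M.hat_nonneg hT (cell_subset T hxT) p)

lemma localEntry_eq_zero (hT : T ∈ M.triangles) {p : Plane} (hp : p ∉ T) (q : Plane) :
    M.localEntry k b c u T p q = 0 := by
  have : ∫ x in cell T, c x * M.hat q x * M.hat p x = 0 :=
    setIntegral_eq_zero_of_forall_eq_zero fun x hx => by
      rw [M.hat_eq_zero hT hp (cell_subset T hx), mul_zero]
  rw [localEntry, M.grad_eq_zero hT hp, this]
  simp

/-- The columns of the element matrix have nonnegative sums. -/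
lemma sum_localEntry_nonneg (h : CoeffBounds (volume.restrict (cell T)) k b c kα kβ Kη Gη)
    (hT : T ∈ M.triangles) (q : Plane) : 0 ≤ ∑ p ∈ T, M.localEntry k b c u T p q := by
  simp only [localEntry, Finset.sum_add_distrib]
  -- Summing over the test index `p` leaves the sum of all gradients on `T`, which is zero.
  rw [← Finset.mul_sum, ← Finset.mul_sum, ← inner_sum, ← inner_sum, M.sum_grad hT, inner_zero_right,
    inner_zero_right, mul_zero, mul_zero, zero_add, zero_add]
  exact Finset.sum_nonneg fun p _ => h.integral_c_nonneg hT p q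

/-- The off-diagonal entries of the element matrix. -/
lemma IsTriple.localEntry_le {p q r : Plane} (ht : M.IsTriple T p q r)
    (h : CoeffBounds (volume.restrict (cell T)) k b c kα kβ Kη Gη) {δ : ℝ}
    (hδ : ∀ y ∈ T, ∀ z ∈ T, |u y - u z| ≤ δ)
    (h₁ : 0 ≤ Real.cot (EuclideanGeometry.angle p r q))
    (h₂ : 0 ≤ Real.cot (EuclideanGeometry.angle p q r)) :
    M.localEntry k b c u T p q ≤ -(kα / 2) * Real.cot (EuclideanGeometry.angle p r q) +
      Kη * δ / 6 * (Real.cot (EuclideanGeometry.angle p r q) +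
        Real.cot (EuclideanGeometry.angle p q r)) + Gη * area T / 12 := by
  have hp : p ∈ T := by rw [ht.eq]; simp
  have hq : q ∈ T := by rw [ht.eq]; simp
  have hr : r ∈ T := by rw [ht.eq]; simp
  have ha := M.area_pos ht.mem
  have e1 := ht.inner_grad
  have e2 := ht.swap.inner_grad
  set α := Real.cot (EuclideanGeometry.angle p r q)
  set β := Real.cot (EuclideanGeometry.angle p q r)
  set X := inner ℝ (M.grad T q) (M.grad T p) with hX
  set Y := inner ℝ (M.grad T r) (M.grad T p) with hY
  have hX0 : X ≤ 0 := by
    by_contra! hc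
    have := mul_pos hc ha
    linarith
  have t1 : (∫ x in cell T, k x) * X ≤ -(kα / 2) * α := by
    have := mul_le_mul_of_nonpos_right h.le_integral_k hX0
    calc _ ≤ kα * area T * X := this
      _ = kα * (X * area T) := by ring
      _ = _ := by rw [e1]; ring
  -- Eliminating `∇φ_p` through the zero sum of the gradients leaves only differences of nodal
  -- values.
  have hU : inner ℝ (M.nodalGrad T u) (M.grad T p) = (u q - u p) * X + (u r - u p) * Y := by
    have hs := M.sum_grad ht.mem
    rw [ht.sum_eq] at hs
    have hp' : M.grad T p = -(M.grad T q + M.grad T r) := eq_neg_of_add_eq_zero_left hs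
    have : M.nodalGrad T u = (u q - u p) • M.grad T q + (u r - u p) • M.grad T r := by
      rw [nodalGrad, ht.sum_eq, hp']; module
    rw [this, inner_add_left, real_inner_smul_left, real_inner_smul_left]
  -- Multiplied by the area, the two inner products become `-α/2` and `-β/2`.
  have hUa : |inner ℝ (M.nodalGrad T u) (M.grad T p)| * area T ≤ δ * (α + β) / 2 := by
    rw [hU, show ∀ t : ℝ, |t| * area T = |t| * |area T| from fun t => by rw [abs_of_pos ha], ← abs_mul, add_mul, mul_assoc, mul_assoc, e1, e2]
    refine (abs_add_le _ _).trans ?_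
    rw [abs_mul, abs_mul, neg_div, neg_div, abs_neg, abs_neg, abs_of_nonneg (by positivity : 0 ≤ α / 2),
      abs_of_nonneg (by positivity : 0 ≤ β / 2)]
    have := mul_le_mul_of_nonneg_right (hδ q hq p hp) (by positivity : 0 ≤ α / 2)
    have := mul_le_mul_of_nonneg_right (hδ r hr p hp) (by positivity : 0 ≤ β / 2)
    linarith
  have hK : 0 ≤ Kη := by
    have := (abs_nonneg _).trans (h.abs_integral_b_le ht.mem hq)
    by_contra! hc
    have := mul_neg_of_neg_of_pos hc ha
    linarith
  have t2 : (∫ x in cell T, b x * M.hat q x) * inner ℝ (M.nodalGrad T u) (M.grad T p) ≤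
      Kη * δ / 6 * (α + β) := by
    refine (le_abs_self _).trans ?_
    rw [abs_mul]
    calc _ ≤ Kη * area T / 3 * |inner ℝ (M.nodalGrad T u) (M.grad T p)| :=
          mul_le_mul_of_nonneg_right (h.abs_integral_b_le ht.mem hq) (abs_nonneg _)
      _ = Kη / 3 * (|inner ℝ (M.nodalGrad T u) (M.grad T p)| * area T) := by ring
      _ ≤ Kη / 3 * (δ * (α + β) / 2) := mul_le_mul_of_nonneg_left hUa (by positivity)
      _ = _ := by ring
  exact add_le_add (add_le_add t1 t2) (h.integral_c_le ht.mem hp hq ht.pq)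

end Bounds

/-! ### Assembly -/

/-- The assembled entries, including those of the boundary nodes. -/
def entry (k b c u : Plane → ℝ) (p q : Plane) : ℝ :=
  ∑ T ∈ M.patchTriangles p q, M.localEntry k b c u T p q

/-- Gradients are constant on open triangles, whose union fills the patch up to a null set. -/
lemma assembled_eq_entry {κ g : Plane → ℝ → ℝ} {u₁ u₂ : Plane → ℝ} {kα kβ Kη Gη : ℝ}
    (h : ∀ T ∈ M.triangles, CoeffBounds (volume.restrict (cell T)) (fun x => κ x (u₁ x))
      (meanDeriv κ u₁ u₂) (meanDeriv g u₁ u₂) kα kβ Kη Gη)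
    (h₂ : M.IsPiecewiseLinear u₂) (p q : M.dof) :
    M.assembled κ g u₁ u₂ p q =
      M.entry (fun x => κ x (u₁ x)) (meanDeriv κ u₁ u₂) (meanDeriv g u₁ u₂) u₂ p q := by
  have hmem : ∀ T ∈ M.patchTriangles p q, T ∈ M.triangles :=
    fun T hT => (M.mem_patchTriangles.1 hT).1
  have e1 : ∀ T ∈ M.triangles, Set.EqOn
      (fun x => κ x (u₁ x) * inner ℝ (gradient (M.hat q) x) (gradient (M.hat p) x))
      (fun x => κ x (u₁ x) * inner ℝ (M.grad T q) (M.grad T p)) (cell T) := fun T hT x hx => by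
    simp only [(M.hasGradientAt_hat hT _ hx).gradient]
  have e2 : ∀ T ∈ M.triangles, Set.EqOn
      (fun x => inner ℝ ((meanDeriv κ u₁ u₂ x • gradient u₂ x)) (gradient (M.hat p) x) * M.hat q x)
      (fun x => meanDeriv κ u₁ u₂ x * M.hat q x * inner ℝ (M.nodalGrad T u₂) (M.grad T p))
      (cell T) := fun T hT x hx => by
    simp only [(M.hasGradientAt_hat hT _ hx).gradient, h₂.gradient_eq hT hx, real_inner_smul_left]
    ring
  rw [assembled, M.setIntegral_patch, M.setIntegral_patch, M.setIntegral_patch,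
    ← Finset.sum_add_distrib, ← Finset.sum_add_distrib, entry]
  · refine Finset.sum_congr rfl fun T hT => ?_
    rw [localEntry, setIntegral_congr_fun (isOpen_cell T).measurableSet (e1 T (hmem T hT)),
      setIntegral_congr_fun (isOpen_cell T).measurableSet (e2 T (hmem T hT)),
      integral_mul_const, integral_mul_const]
  · intro T hT
    have hT := hmem T hT
    exact M.integrableOn_mul_hat hT (M.integrableOn_mul_hat hT (h T hT).c_integrable q) p
  · intro T hT
    have hT := hmem T hT
    exact IntegrableOn.congr_fun ((M.integrableOn_mul_hat hT (h T hT).b_integrable q).mul_const _)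
      (e2 T hT).symm (isOpen_cell T).measurableSet
  · intro T hT
    have hT := hmem T hT
    exact IntegrableOn.congr_fun ((h T hT).k_integrable.mul_const _)
      (e1 T hT).symm (isOpen_cell T).measurableSet

open Classical in
/-- All nodes of the mesh. -/
def nodes : Finset Plane := M.triangles.biUnion id

lemma mem_nodes {p : Plane} : p ∈ M.nodes ↔ ∃ T ∈ M.triangles, p ∈ T := by
  simp [nodes]

lemma mem_nodes_of_dof {p : Plane} (hp : p ∈ M.dof) : p ∈ M.nodes := by
  obtain ⟨T, hT, hs, hc⟩ := M.pure _ hp.1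
  exact M.mem_nodes.2 ⟨T, M.mem_triangles.2 ⟨hT, hc⟩, hs (Finset.mem_singleton_self p)⟩

lemma patchTriangles_comm (p q : Plane) : M.patchTriangles p q = M.patchTriangles q p := by
  ext T
  simp only [mem_patchTriangles]
  tauto

-- Reorders a sum over nodes by triangles, so that the element identities apply to columns and rows.
open Classical in
lemma sum_nodes_patchTriangles (q : Plane) (f : Finset Plane → Plane → ℝ) :
    ∑ p ∈ M.nodes, ∑ T ∈ M.patchTriangles p q, f T p =
      ∑ T ∈ M.triangles with q ∈ T, ∑ p ∈ T, f T p := by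
  refine Finset.sum_comm' fun p T => ?_
  simp only [mem_patchTriangles, mem_nodes, Finset.mem_filter]
  exact ⟨fun h => ⟨h.2.2.1, h.2.1, h.2.2.2⟩, fun h => ⟨⟨T, h.2.1, h.1⟩, h.2.1, h.1, h.2.2⟩⟩

lemma sum_entry_nonneg {k b c u : Plane → ℝ} {kα kβ Kη Gη : ℝ}
    (h : ∀ T ∈ M.triangles, CoeffBounds (volume.restrict (cell T)) k b c kα kβ Kη Gη) (q : Plane) :
    0 ≤ ∑ p ∈ M.nodes, M.entry k b c u p q := by
  simp only [entry]
  rw [M.sum_nodes_patchTriangles q fun T p => M.localEntry k b c u T p q]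
  refine Finset.sum_nonneg fun T hT => ?_
  have hT := (Finset.mem_filter.1 hT).1
  exact sum_localEntry_nonneg (h T hT) hT q

lemma area_le_maxArea {T : Finset Plane} (hT : T ∈ M.triangles) : area T ≤ M.maxArea := by
  rw [area_eq_convexHull]
  refine le_csSup (Set.Finite.bddAbove ?_) ⟨T, hT, rfl⟩
  refine (M.triangles.finite_toSet.image
    fun T : Finset Plane => volume.real (convexHull ℝ (T : Set Plane))).subset ?_
  rintro _ ⟨T, hT, rfl⟩
  exact ⟨T, hT, rfl⟩

lemma abs_sub_le_patchVariation {p q : Plane} {T : Finset Plane} (hT : T ∈ M.patchTriangles p q)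
    (u : Plane → ℝ) {y z : Plane} (hy : y ∈ T) (hz : z ∈ T) :
    |u y - u z| ≤ M.patchVariation p q u := by
  refine le_csSup (Set.Finite.bddAbove ?_) ⟨T, hT, y, hy, z, hz, rfl⟩
  have hf : (⋃ T ∈ M.patchTriangles p q, (fun a : Plane × Plane => |u a.1 - u a.2|) ''
      ((T : Set Plane) ×ˢ (T : Set Plane))).Finite :=
    (M.patchTriangles p q).finite_toSet.biUnion fun T _ =>
      (T.finite_toSet.prod T.finite_toSet).image _
  refine hf.subset ?_
  rintro _ ⟨T, hT, y, hy, z, hz, rfl⟩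
  exact Set.mem_biUnion hT ⟨(y, z), ⟨hy, hz⟩, rfl⟩

variable {M} in
open Classical in
lemma IsTriple.sum_erase {T : Finset Plane} {p q r : Plane} (h : M.IsTriple T p q r)
    (f : Plane → ℝ) : ∑ y ∈ (T.erase p).erase q, f y = f r := by
  have : (T.erase p).erase q = {r} := by
    ext y
    have h1 := h.pr
    have h2 := h.qr
    simp only [Finset.mem_erase, h.eq, Finset.mem_insert, Finset.mem_singleton]
    constructor
    · tauto
    · rintro rfl; tauto
  rw [this, Finset.sum_singleton]

lemma cot_nonneg_of_angle_le {p q r : Plane}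
    (h : EuclideanGeometry.angle p q r ≤ Real.pi / 2) :
    0 ≤ Real.cot (EuclideanGeometry.angle p q r) := by
  have h0 := EuclideanGeometry.angle_nonneg p q r
  rw [Real.cot_eq_cos_div_sin]
  exact div_nonneg (Real.cos_nonneg_of_neg_pi_div_two_le_of_le (by linarith [Real.pi_pos]) h)
    (Real.sin_nonneg_of_nonneg_of_le_pi h0 (EuclideanGeometry.angle_le_pi p q r))

variable {M} in
lemma IsEdge.symm {p q : Plane} (h : M.IsEdge p q) : M.IsEdge q p :=
  ⟨h.1.symm, by rw [M.patchTriangles_comm]; exact h.2.1, h.2.2.symm⟩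

/-- The off-diagonal entries that belong to an edge are negative. -/
lemma entry_neg {k b c u : Plane → ℝ} {kα kβ Kη Gη βm βM : ℝ}
    (h : ∀ T ∈ M.triangles, CoeffBounds (volume.restrict (cell T)) k b c kα kβ Kη Gη)
    (hα : 0 < kα) (hK : 0 < Kη)
    (hmesh : M.AngleConditions βm βM) (hu : M.NodalConditions kα Kη Gη βm βM u) {p q : Plane}
    (hpq : M.IsEdge p q) : M.entry k b c u p q < 0 := by
  classical
  set δ := M.patchVariation p q u with hδ
  set A := M.maxArea with hA
  obtain ⟨T₀, hT₀⟩ := hpq.2.1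
  have hT₀' := M.mem_patchTriangles.1 hT₀
  have hG : 0 ≤ Gη := (h T₀ hT₀'.1).bound_nonneg hT₀'.1
  have hA0 : 0 ≤ A := (M.area_pos hT₀'.1).le.trans (M.area_le_maxArea hT₀'.1)
  have hδ0 : 0 ≤ δ := (abs_nonneg _).trans
    (M.abs_sub_le_patchVariation hT₀ u hT₀'.2.1 hT₀'.2.2)
  -- The second angle is the one at `q`, so the mesh condition is needed for the ordering `q`, `p`.
  have hbound : M.entry k b c u p q ≤ -(kα / 2) * M.cotOpposite p q +
      Kη * δ / 6 * (M.cotOpposite q p + M.cotAt q p) +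
      (M.patchTriangles p q).card * (Gη * A / 12) := by
    rw [entry, cotOpposite, cotOpposite, cotAt, M.patchTriangles_comm q p,
      ← Finset.sum_add_distrib, Finset.mul_sum, Finset.mul_sum, ← nsmul_eq_mul, ← Finset.sum_const,
      ← Finset.sum_add_distrib, ← Finset.sum_add_distrib]
    refine Finset.sum_le_sum fun T hT => ?_
    obtain ⟨hTM, hp, hq⟩ := M.mem_patchTriangles.1 hT
    obtain ⟨r, ht⟩ := M.exists_isTriple_of_pair hTM hp hq hpq.1
    have hr : r ∈ T := by rw [ht.eq]; simp
    have hle := ht.localEntry_le (h T hTM) (u := u) (δ := δ)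
      (fun y hy z hz => M.abs_sub_le_patchVariation hT u hy hz)
      (cot_nonneg_of_angle_le (hmesh.nonobtuse T hTM p hp r hr q hq ht.pr ht.qr.symm ht.pq))
      (cot_nonneg_of_angle_le (hmesh.nonobtuse T hTM p hp q hq r hr ht.pq ht.qr ht.pr))
    rw [ht.sum_erase, ht.rotate.swap.sum_erase, ht.rotate.swap.sum_erase,
      EuclideanGeometry.angle_comm q r p]
    have := mul_le_mul_of_nonneg_left (M.area_le_maxArea hTM) hG
    linarith
  have hcard : ((M.patchTriangles p q).card : ℝ) ≤ 2 := by
    exact_mod_cast M.card_patchTriangles_le hpq.1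
  have h1 := mul_le_mul_of_nonneg_right hcard (by positivity : 0 ≤ Gη * A / 12)
  have h2 := mul_le_mul_of_nonneg_left (hmesh.smallest q p hpq.symm)
    (by positivity : 0 ≤ Kη * δ / 6)
  have h3 := mul_lt_mul_of_pos_left (hmesh.opposite p q hpq) (by positivity : 0 < kα / 2)
  have hm := hmesh.βm_pos
  -- With two triangles the bound is below `-kα βm/2 + Kη δ βM/6 + Gη A/6`, which is nonpositive by
  -- the nodal condition. Strictness comes from `βm < M.cotOpposite p q`.
  have h4 := hu.offDiag p q hpq
  rw [one_div, inv_mul_le_iff₀ (by positivity)] at h4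
  linarith

/-! ### The linearized problem -/

lemma coeffBounds {κ g : Plane → ℝ → ℝ} {kα kβ Kη Gη : ℝ}
    (hdata : DataBounds Ω κ g kα kβ Kη Gη) {u₁ u₂ : Plane → ℝ} (h₁ : M.IsPiecewiseLinear u₁)
    (h₂ : M.IsPiecewiseLinear u₂) {T : Finset Plane} (hT : T ∈ M.triangles) :
    CoeffBounds (volume.restrict (cell T)) (fun x => κ x (u₁ x)) (meanDeriv κ u₁ u₂)
      (meanDeriv g u₁ u₂) kα kβ Kη Gη := by
  have hle := M.restrict_cell_le hT
  have hm : ∀ {u : Plane → ℝ}, M.IsPiecewiseLinear u →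
      AEMeasurable u (volume.restrict (cell T)) := fun hu =>
    (((hu.continuousOn hT).mono (cell_subset T)).aestronglyMeasurable
      (isOpen_cell T).measurableSet).aemeasurable
  have hκ : ∀ η, AEMeasurable (fun x => κ x η) (volume.restrict (cell T)) :=
    fun η => (hdata.κ_meas η).mono_measure hle
  have hg : ∀ η, AEMeasurable (fun x => g x η) (volume.restrict (cell T)) :=
    fun η => (hdata.g_meas η).mono_measure hle
  have hκC := ae_mono hle hdata.κ_C1
  have hgC := ae_mono hle hdata.g_C1
  refine ⟨?_, ?_, ?_, ?_, ?_, ?_⟩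
  · exact (aemeasurable_caratheodory hκ (Filter.Eventually.mono hκC fun x hx => ContDiff.continuous hx)
      (hm h₁)).aestronglyMeasurable
  · exact (aemeasurable_meanDeriv hκ hκC (hm h₁) (hm h₂)).aestronglyMeasurable
  · exact (aemeasurable_meanDeriv hg hgC (hm h₁) (hm h₂)).aestronglyMeasurable
  · filter_upwards [ae_mono hle hdata.κ_bounds] with x hx using hx _
  · filter_upwards [ae_mono hle hdata.κ_deriv] with x hx using abs_meanDeriv_le hx
  · filter_upwards [ae_mono hle hdata.g_deriv] with x hx
    exact ⟨meanDeriv_nonneg fun η => (hx η).1, (le_abs_self _).trans (abs_meanDeriv_le fun η => by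
      rw [abs_of_nonneg (hx η).1]; exact (hx η).2)⟩

/-- The three inputs of `monotoneMatrix_of_columns` are `entry_neg`, `sum_entry_nonneg` and
`exists_neighbour_notMem`; entries of nodes without a common triangle are empty sums. -/
theorem monotoneMatrix_assembled {κ g : Plane → ℝ → ℝ} {kα kβ Kη Gη βm βM : ℝ}
    (hdata : DataBounds Ω κ g kα kβ Kη Gη) (hmesh : M.AngleConditions βm βM) {u₁ u₂ : Plane → ℝ}
    (h₁ : u₁ ∈ M.discreteSpace) (h₂ : u₂ ∈ M.discreteSpace)
    (hu : M.NodalConditions kα Kη Gη βm βM u₂) : MonotoneMatrix (M.assembled κ g u₁ u₂) := by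
  have hP₁ := M.isPiecewiseLinear_of_mem h₁
  have hP₂ := M.isPiecewiseLinear_of_mem h₂
  have hC := fun T hT => M.coeffBounds hdata hP₁ hP₂ (T := T) hT
  have hA : M.assembled κ g u₁ u₂ = fun i j : M.dof => M.entry (fun x => κ x (u₁ x))
      (meanDeriv κ u₁ u₂) (meanDeriv g u₁ u₂) u₂ i j := by
    ext i j
    exact M.assembled_eq_entry hC hP₂ i j
  rw [hA]
  refine monotoneMatrix_of_columns M.nodes M.dof (fun j hj => M.mem_nodes_of_dof hj) _ ?_
    (fun j _ => M.sum_entry_nonneg hC j) ?_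
  · intro p _ j hj hpj
    by_cases he : (M.patchTriangles p j).Nonempty
    · exact (M.entry_neg hC hdata.kα_pos hdata.Kη_pos hmesh hu ⟨hpj, he, Or.inr hj⟩).le
    · rw [entry, Finset.not_nonempty_iff_eq_empty.1 he, Finset.sum_empty]
  · intro N hN hne
    obtain ⟨j, hj, T, hT, hjT, p, hpT, hp⟩ := M.exists_neighbour_notMem hN hne
    refine ⟨j, hj, p, M.mem_nodes.2 ⟨T, hT, hpT⟩, hp, ?_⟩
    exact M.entry_neg hC hdata.kα_pos hdata.Kη_pos hmesh hu
      ⟨fun h => hp (h ▸ hj), ⟨T, M.mem_patchTriangles.2 ⟨hT, hpT, hjT⟩⟩, Or.inr (hN hj)⟩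

/-! ### From two discrete solutions to the kernel of the matrix. -/

/-- The integrand of the discrete problem for the solution `u` and the test function `v`. -/
def formIntegrand (κ g : Plane → ℝ → ℝ) (u v : Plane → ℝ) (x : Plane) : ℝ :=
  κ x (u x) * inner ℝ (gradient u x) (gradient v x) + g x (u x) * v x

/-- On each triangle, the difference of the discrete forms is given by the element matrix. -/
lemma setIntegral_cell_sub {κ g : Plane → ℝ → ℝ} {kα kβ Kη Gη : ℝ}
    (hdata : DataBounds Ω κ g kα kβ Kη Gη) {u₁ u₂ : Plane → ℝ} (h₁ : M.IsPiecewiseLinear u₁)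
    (h₂ : M.IsPiecewiseLinear u₂) {T : Finset Plane} (hT : T ∈ M.triangles) (p : Plane) :
    ∫ x in cell T, (formIntegrand κ g u₁ (M.hat p) x - formIntegrand κ g u₂ (M.hat p) x) =
      ∑ q ∈ T, M.localEntry (fun x => κ x (u₁ x)) (meanDeriv κ u₁ u₂) (meanDeriv g u₁ u₂) u₂ T p q *
        (u₁ q - u₂ q) := by
  have hC := M.coeffBounds hdata h₁ h₂ hT
  have hle := M.restrict_cell_le hT
  have hk : ∀ q, IntegrableOn (fun x => κ x (u₁ x) * inner ℝ (M.grad T q) (M.grad T p))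
    (cell T) := fun q => hC.k_integrable.mul_const _
  have hb : ∀ q, IntegrableOn (fun x => meanDeriv κ u₁ u₂ x * M.hat q x *
      inner ℝ (M.nodalGrad T u₂) (M.grad T p)) (cell T) :=
    fun q => (M.integrableOn_mul_hat hT hC.b_integrable q).mul_const _
  have hc : ∀ q, IntegrableOn (fun x => meanDeriv g u₁ u₂ x * M.hat q x * M.hat p x) (cell T) :=
    fun q => M.integrableOn_mul_hat hT (M.integrableOn_mul_hat hT hC.c_integrable q) p
  have hkb : ∀ q, IntegrableOn (fun x => κ x (u₁ x) * inner ℝ (M.grad T q) (M.grad T p) +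
      meanDeriv κ u₁ u₂ x * M.hat q x * inner ℝ (M.nodalGrad T u₂) (M.grad T p)) (cell T) :=
    fun q => (hk q).add (hb q)
  have hkbc : ∀ q, IntegrableOn (fun x => (κ x (u₁ x) * inner ℝ (M.grad T q) (M.grad T p) +
      meanDeriv κ u₁ u₂ x * M.hat q x * inner ℝ (M.nodalGrad T u₂) (M.grad T p) +
      meanDeriv g u₁ u₂ x * M.hat q x * M.hat p x) * (u₁ q - u₂ q)) (cell T) :=
    fun q => ((hkb q).add (hc q)).mul_const _
  have hlocal : ∀ q, M.localEntry (fun x => κ x (u₁ x)) (meanDeriv κ u₁ u₂) (meanDeriv g u₁ u₂) u₂ T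
      p q * (u₁ q - u₂ q) = ∫ x in cell T,
      (κ x (u₁ x) * inner ℝ (M.grad T q) (M.grad T p) + meanDeriv κ u₁ u₂ x * M.hat q x *
      inner ℝ (M.nodalGrad T u₂) (M.grad T p) + meanDeriv g u₁ u₂ x * M.hat q x * M.hat p x) *
        (u₁ q - u₂ q) := by
    intro q
    rw [integral_mul_const, integral_add (hkb q) (hc q), integral_add (hk q) (hb q),
      integral_mul_const, integral_mul_const, localEntry]
  simp only [hlocal]
  rw [← integral_finsetSum _ fun q _ => hkbc q]
  refine integral_congr_ae ?_
  filter_upwards [ae_mono hle hdata.κ_C1, ae_mono hle hdata.g_C1, ae_mem_cell T] with x hκ hg hx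
  -- The integrands agree pointwise: `κ(u₁)∇u₁ - κ(u₂)∇u₂` splits into `κ(u₁)∇(u₁-u₂)` and
  -- `(κ(u₁)-κ(u₂))∇u₂`, and `e1`, `e2` rewrite the differences of `κ` and `g`.
  have e1 := meanDeriv_mul_sub (u₁ := u₁) (u₂ := u₂) hκ
  have e2 := meanDeriv_mul_sub (u₁ := u₁) (u₂ := u₂) hg
  have hw : u₁ x - u₂ x = ∑ q ∈ T, M.hat q x * (u₁ q - u₂ q) := by
    rw [h₁ T hT x (cell_subset T hx), h₂ T hT x (cell_subset T hx), ← Finset.sum_sub_distrib]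
    exact Finset.sum_congr rfl fun q _ => by ring
  have hG : inner ℝ (M.nodalGrad T u₁) (M.grad T p) - inner ℝ (M.nodalGrad T u₂) (M.grad T p) =
      ∑ q ∈ T, inner ℝ (M.grad T q) (M.grad T p) * (u₁ q - u₂ q) := by
    simp only [nodalGrad, sum_inner, real_inner_smul_left]
    rw [← Finset.sum_sub_distrib]
    exact Finset.sum_congr rfl fun q _ => by ring
  have hsum : ∑ q ∈ T, (κ x (u₁ x) * inner ℝ (M.grad T q) (M.grad T p) +
      meanDeriv κ u₁ u₂ x * M.hat q x * inner ℝ (M.nodalGrad T u₂) (M.grad T p) +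
      meanDeriv g u₁ u₂ x * M.hat q x * M.hat p x) * (u₁ q - u₂ q) =
      κ x (u₁ x) * (∑ q ∈ T, inner ℝ (M.grad T q) (M.grad T p) * (u₁ q - u₂ q)) +
      meanDeriv κ u₁ u₂ x * (∑ q ∈ T, M.hat q x * (u₁ q - u₂ q)) *
        inner ℝ (M.nodalGrad T u₂) (M.grad T p) +
      meanDeriv g u₁ u₂ x * (∑ q ∈ T, M.hat q x * (u₁ q - u₂ q)) * M.hat p x := by
    simp only [Finset.mul_sum, Finset.sum_mul]
    rw [← Finset.sum_add_distrib, ← Finset.sum_add_distrib]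
    exact Finset.sum_congr rfl fun q _ => by ring
  simp only [formIntegrand]
  rw [hsum, ← hw, ← hG, e1, e2, h₁.gradient_eq hT hx, h₂.gradient_eq hT hx,
    (M.hasGradientAt_hat hT p hx).gradient]
  ring

lemma eq_zero_of_mem_discreteSpace {u : Plane → ℝ} (hu : u ∈ M.discreteSpace) {p : Plane}
    (hp : p ∈ M.nodes) (hpd : p ∉ M.dof) : u p = 0 := by
  obtain ⟨T, hT, hpT⟩ := M.mem_nodes.1 hp
  rw [M.eq_sum_hat hu]
  refine Finset.sum_eq_zero fun q _ => ?_
  rw [M.hat_vertex (M.mem_vertices_of_mem hT hpT), if_neg, mul_zero]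
  rintro rfl
  exact hpd q.2

/-- The nodal difference of two discrete solutions lies in the kernel of the linearized matrix. -/
lemma mulVec_assembled_eq_zero {κ g : Plane → ℝ → ℝ} {kα kβ Kη Gη : ℝ}
    (hdata : DataBounds Ω κ g kα kβ Kη Gη) {f u₁ u₂ : Plane → ℝ}
    (h₁ : M.IsDiscreteSolution κ g f u₁) (h₂ : M.IsDiscreteSolution κ g f u₂) :
    (M.assembled κ g u₁ u₂).mulVec (fun q => u₁ q - u₂ q) = 0 := by
  classical
  have hP₁ := M.isPiecewiseLinear_of_mem h₁.1
  have hP₂ := M.isPiecewiseLinear_of_mem h₂.1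
  ext p
  have hp : M.hat p ∈ M.discreteSpace := Submodule.subset_span ⟨p, p.2, rfl⟩
  obtain ⟨hi₁, he₁⟩ := h₁.2 _ hp
  obtain ⟨hi₂, he₂⟩ := h₂.2 _ hp
  have hzero : ∫ x in Ω, (formIntegrand κ g u₁ (M.hat p) x - formIntegrand κ g u₂ (M.hat p) x) =
      0 := by
    refine (integral_sub hi₁ hi₂).trans ?_
    rw [he₁, he₂, sub_self]
  have hint : IntegrableOn
      (fun x => formIntegrand κ g u₁ (M.hat p) x - formIntegrand κ g u₂ (M.hat p) x) Ω :=
    hi₁.sub hi₂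
  rw [M.setIntegral_domain hint] at hzero
  rw [Finset.sum_congr rfl fun T hT => M.setIntegral_cell_sub hdata hP₁ hP₂ hT p] at hzero
  set E := M.localEntry (fun x => κ x (u₁ x)) (meanDeriv κ u₁ u₂) (meanDeriv g u₁ u₂) u₂ with hE
  -- Boundary nodes may be added to the row, since both solutions vanish there.
  have hrow : ∑ q : M.dof, M.assembled κ g u₁ u₂ p q * (u₁ q - u₂ q) =
      ∑ q ∈ M.nodes, ∑ T ∈ M.patchTriangles q p, E T p q * (u₁ q - u₂ q) := by
    have hsub : Finset.univ.map (Function.Embedding.subtype (· ∈ M.dof)) ⊆ M.nodes := by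
      intro q hq
      obtain ⟨q, -, rfl⟩ := Finset.mem_map.1 hq
      exact M.mem_nodes_of_dof q.2
    rw [← Finset.sum_subset hsub, Finset.sum_map]
    · refine Finset.sum_congr rfl fun q _ => ?_
      rw [M.assembled_eq_entry (fun T hT => M.coeffBounds hdata hP₁ hP₂ hT) hP₂, entry,
        M.patchTriangles_comm, Finset.sum_mul]
      rfl
    · intro q hq hqd
      have hqd' : q ∉ M.dof := fun h => hqd (Finset.mem_map.2 ⟨⟨q, h⟩, Finset.mem_univ _, rfl⟩)
      refine Finset.sum_eq_zero fun T _ => ?_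
      rw [M.eq_zero_of_mem_discreteSpace h₁.1 hq hqd',
        M.eq_zero_of_mem_discreteSpace h₂.1 hq hqd', sub_self, mul_zero]
  refine hrow.trans ?_
  rw [M.sum_nodes_patchTriangles p fun T q => E T p q * (u₁ q - u₂ q)]
  refine Eq.trans ?_ hzero
  -- Triangles without the vertex `p` contribute nothing, as the test function vanishes on them.
  refine Finset.sum_subset (Finset.filter_subset _ _) fun T hT hTp => ?_
  have hpT : (p : Plane) ∉ T := fun h => hTp (Finset.mem_filter.2 ⟨hT, h⟩)
  exact Finset.sum_eq_zero fun q _ => by rw [hE, localEntry_eq_zero hT hpT, zero_mul]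

/-- A discrete solution that satisfies the nodal conditions is the only discrete solution. -/
theorem eq_of_isDiscreteSolution {κ g : Plane → ℝ → ℝ} {kα kβ Kη Gη βm βM : ℝ}
    (hdata : DataBounds Ω κ g kα kβ Kη Gη) (hmesh : M.AngleConditions βm βM) {f u₁ u₂ : Plane → ℝ}
    (h₁ : M.IsDiscreteSolution κ g f u₁) (h₂ : M.IsDiscreteSolution κ g f u₂)
    (hu : M.NodalConditions kα Kη Gη βm βM u₂) : u₁ = u₂ := by
  have hmono := M.monotoneMatrix_assembled hdata hmesh h₁.1 h₂.1 hu
  have hker := M.mulVec_assembled_eq_zero hdata h₁ h₂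
  -- A monotone matrix is injective: a kernel vector and its negative are both nonnegative.
  have hpos := hmono _ hker.ge
  have hneg := hmono (-fun q : M.dof => u₁ q - u₂ q) (by rw [Matrix.mulVec_neg, hker, neg_zero])
  have heq : ∀ q : M.dof, u₁ q = u₂ q := by
    intro q
    have a1 := hpos q
    have a2 := hneg q
    simp only [Pi.zero_apply, Pi.neg_apply] at a1 a2
    linarith
  ext x
  rw [M.eq_sum_hat h₁.1, M.eq_sum_hat h₂.1]
  exact Finset.sum_congr rfl fun q _ => by rw [heq q]

end Triangulation

end

theorem mainTheorem1 {Ω : Set Plane} (M : Triangulation Ω) (κ g : Plane → ℝ → ℝ)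
    (kα kβ Kη Gη βm βM : ℝ) (hdata : DataBounds Ω κ g kα kβ Kη Gη)
    (hmesh : M.AngleConditions βm βM) :
    (∀ u₁ ∈ M.discreteSpace, ∀ u₂ ∈ M.discreteSpace,
      M.NodalConditions kα Kη Gη βm βM u₂ → MonotoneMatrix (M.assembled κ g u₁ u₂)) ∧
    (∀ f : Plane → ℝ, MemLp f 2 (volume.restrict Ω) →
      ∀ u₂, M.IsDiscreteSolution κ g f u₂ → M.NodalConditions kα Kη Gη βm βM u₂ →
        ∀ u₁, M.IsDiscreteSolution κ g f u₁ → u₁ = u₂) ∧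
    (∀ f : Plane → ℝ, MemLp f 2 (volume.restrict Ω) →
      (∀ u, M.IsDiscreteSolution κ g f u → M.NodalConditions kα Kη Gη βm βM u) →
        ∀ u₁ u₂, M.IsDiscreteSolution κ g f u₁ → M.IsDiscreteSolution κ g f u₂ → u₁ = u₂) :=
  ⟨fun _ h₁ _ h₂ hu => M.monotoneMatrix_assembled hdata hmesh h₁ h₂ hu,
    fun _ _ _ h₂ hu _ h₁ => M.eq_of_isDiscreteSolution hdata hmesh h₁ h₂ hu,
    fun _ _ h _ _ h₁ h₂ => M.eq_of_isDiscreteSolution hdata hmesh h₁ h₂ (h _ h₂)⟩
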